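/- Let $n\in\mathbb{N}$ and let $\rho$ be either (i) the density of the uniform distribution on a nonempty, open, bounded, convex set in $\mathbb{R}^n$, or (ii) the density of the standard normal distribution $\mathcal N(0,I)$ on $\mathbb{R}^n$; put $\mathcal X=\{x:\rho(x)>0\}$. Then there is a constant $C>0$, depending only on $\rho$, such that the following holds. Let $X$ be an $\mathbb{R}^n$-valued random variable with Lebesgue density $\rho$, and let $f:\mathcal X\to\mathbb{R}$ be measurable, with partial derivatives that exist everywhere on $\mathcal X$ and are square integrable with respect to $\rho$. Let $$\int_{\mathcal X}\nabla f(x)\,\nabla f(x)^\top\rho(x)\,dx = W\,\mathrm{diag}(\lambda_1,\dots,\lambda_n)\,W^\top$$ with $W$ orthogonal and $\lambda_1\ge\dots\ge\lambda_n$. Let $1\le k\le n-1$, let $\varepsilon>0$, and let $\hat W=[\hat W_1\ \hat W_2]$ be an orthogonal $n\times n$ matrix, $\hat W_1$ consisting of its first $k$ columns, with $\|W-\hat W\|\le\varepsilon$ in the Euclidean operator norm. Define $$\hat g(\hat y)=\int_{\mathbb{R}^{n-k}} f(\hat W_1\hat y+\hat W_2\hat z)\,\rho_{\hat Z|\hat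 Y}(\hat z\,|\,\hat y)\,d\hat z,\qquad f_{\hat g}(x)=\hat g(\hat W_1^\top x),$$ $$\rho_{\hat Z|\hat Y}(\hat z\,|\,\hat y)=\frac{\rho(\hat W_1\hat y+\hat W_2\hat z)}{\int_{\mathbb{R}^{n-k}}\rho(\hat W_1\hat y+\hat W_2 z)\,dz}\quad(\hat y\in\hat W_1^\top\mathcal X),$$ where $f(\hat W_1\hat y+\hat W_2\hat z)\,\rho_{\hat Z|\hat Y}(\hat z\,|\,\hat y)$ is read as $0$ when $\hat W_1\hat y+\hat W_2\hat z\notin\mathcal X$. Then, for almost every value $\hat y$ of $\hat W_1^\top X$, the integral defining $\hat g(\hat y)$ converges absolutely, $(f(X)-f_{\hat g}(X))^2$ is integrable, and $$\mathbb{E}\left[\left(f(X)-f_{\hat g}(X)\right)^2\right]\le C\left(\varepsilon\,(\lambda_1+\dots+\lambda_k)^{1/2}+(\lambda_{k+1}+\dots+\lambda_n)^{1/2}\right)^2 .$$ -/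

import Mathlib

open MeasureTheory
open scoped Matrix

namespace ActiveSubspace

noncomputable section

/-- The domain `𝒳 = {x ∈ ℝⁿ | ρ(x) > 0}` of points of positive density. -/
def domain {n : ℕ} (ρ : (Fin n → ℝ) → ℝ) : Set (Fin n → ℝ) := {x | 0 < ρ x}

/-- The density of the uniform distribution on a set `U ⊆ ℝⁿ`. -/
def uniformDensity {n : ℕ} (U : Set (Fin n → ℝ)) : (Fin n → ℝ) → ℝ :=
  U.indicator fun _ => (volume.real U)⁻¹

/-- `ρ` is the density of the uniform distribution on an open, nonempty, bounded, convex set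
(which is then the domain of `ρ`). -/
def IsUniformOnConvex {n : ℕ} (ρ : (Fin n → ℝ) → ℝ) : Prop :=
  ∃ U : Set (Fin n → ℝ), IsOpen U ∧ U.Nonempty ∧ Bornology.IsBounded U ∧ Convex ℝ U ∧
    ρ = uniformDensity U

/-- The density of the standard normal distribution `N(0, I)` on `ℝⁿ`. -/
def stdNormalDensity (n : ℕ) : (Fin n → ℝ) → ℝ :=
  fun x => ∏ i, ProbabilityTheory.gaussianPDFReal 0 1 (x i)

/-- The `i`-th partial derivative of `f` at `x`. -/
def partialDeriv {n : ℕ} (f : (Fin n → ℝ) → ℝ) (i : Fin n) (x : Fin n → ℝ) : ℝ :=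
  lineDeriv ℝ f x (Pi.single i 1)

/-- `f` is measurable on `𝒳` and has, at every point of `𝒳`, all partial derivatives, and these
are square integrable with respect to `ρ`.  Only the values of `f` on the (open) set `𝒳` matter. -/
structure IsAdmissible {n : ℕ} (ρ f : (Fin n → ℝ) → ℝ) : Prop where
  measurable : Measurable ((domain ρ).domRestrict f)
  hasPartials : ∀ x ∈ domain ρ, ∀ i : Fin n, LineDifferentiableAt ℝ f x (Pi.single i 1)
  sqIntegrable : ∀ i : Fin n,
    IntegrableOn (fun x => partialDeriv f i x ^ 2 * ρ x) (domain ρ) volume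

/-- The matrix `∫_𝒳 ∇f(x) ∇f(x)ᵀ ρ(x) dx`. -/
def gradMatrix {n : ℕ} (ρ f : (Fin n → ℝ) → ℝ) : Matrix (Fin n) (Fin n) ℝ :=
  Matrix.of fun i j => ∫ x in domain ρ, partialDeriv f i x * partialDeriv f j x * ρ x

/-- `A = W diag(l₁, …, lₙ) Wᵀ` with `W` orthogonal and `l₁ ≥ ⋯ ≥ lₙ`. -/
structure IsEigendecomposition {n : ℕ} (A W : Matrix (Fin n) (Fin n) ℝ) (l : Fin n → ℝ) :
    Prop where
  orthogonal : W ∈ Matrix.orthogonalGroup (Fin n) ℝ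
  antitone : Antitone l
  eq_mul : A = W * Matrix.diagonal l * Wᵀ

/-- The first `k` columns `W₁` of `W = [W₁ W₂]`. -/
def firstCols {n k : ℕ} (hk : k < n) (W : Matrix (Fin n) (Fin n) ℝ) :
    Matrix (Fin n) (Fin k) ℝ :=
  W.submatrix id fun j => ⟨j, j.isLt.trans hk⟩

/-- The last `n - k` columns `W₂` of `W = [W₁ W₂]`. -/
def lastCols {n k : ℕ} (hk : k < n) (W : Matrix (Fin n) (Fin n) ℝ) :
    Matrix (Fin n) (Fin (n - k)) ℝ :=
  W.submatrix id fun j => ⟨k + j, by have := j.isLt; omega⟩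

/-- The point `W₁ y + W₂ z ∈ ℝⁿ`. -/
def point {n k : ℕ} (hk : k < n) (W : Matrix (Fin n) (Fin n) ℝ)
    (y : Fin k → ℝ) (z : Fin (n - k) → ℝ) : Fin n → ℝ :=
  firstCols hk W *ᵥ y + lastCols hk W *ᵥ z

/-- The joint density of `(Y, Z) = (W₁ᵀ X, W₂ᵀ X)`. -/
def jointDensity {n k : ℕ} (hk : k < n) (ρ : (Fin n → ℝ) → ℝ) (W : Matrix (Fin n) (Fin n) ℝ)
    (y : Fin k → ℝ) (z : Fin (n - k) → ℝ) : ℝ :=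
  ρ (point hk W y z)

/-- The marginal density of `Y = W₁ᵀ X`. -/
def marginalDensity {n k : ℕ} (hk : k < n) (ρ : (Fin n → ℝ) → ℝ)
    (W : Matrix (Fin n) (Fin n) ℝ) (y : Fin k → ℝ) : ℝ :=
  ∫ z : Fin (n - k) → ℝ, jointDensity hk ρ W y z

/-- The conditional density of `Z = W₂ᵀ X` given `Y = y`.  For `y ∉ W₁ᵀ 𝒳` the numerator
vanishes (when `ρ ≥ 0` and `W` is orthogonal), so that the value is `0` there. -/
def condDensity {n k : ℕ} (hk : k < n) (ρ : (Fin n → ℝ) → ℝ) (W : Matrix (Fin n) (Fin n) ℝ)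
    (y : Fin k → ℝ) (z : Fin (n - k) → ℝ) : ℝ :=
  jointDensity hk ρ W y z / marginalDensity hk ρ W y

/-- The conditional expectation
`g(y) = ∫ f(W₁ y + W₂ z) ρ(z | y) dz` of `f(X)` given `W₁ᵀ X = y`. -/
def condMean {n k : ℕ} (hk : k < n) (ρ f : (Fin n → ℝ) → ℝ) (W : Matrix (Fin n) (Fin n) ℝ)
    (y : Fin k → ℝ) : ℝ :=
  ∫ z : Fin (n - k) → ℝ, f (point hk W y z) * condDensity hk ρ W y z

/-- The ridge approximation `f_g(x) = g(W₁ᵀ x)` of `f`. -/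
def ridgeApprox {n k : ℕ} (hk : k < n) (ρ f : (Fin n → ℝ) → ℝ) (W : Matrix (Fin n) (Fin n) ℝ)
    (x : Fin n → ℝ) : ℝ :=
  condMean hk ρ f W ((firstCols hk W)ᵀ *ᵥ x)

/-- The Euclidean operator (spectral) norm of a square matrix. -/
def spectralNorm {n : ℕ} (A : Matrix (Fin n) (Fin n) ℝ) : ℝ :=
  ‖Matrix.toEuclideanCLM (n := Fin n) (𝕜 := ℝ) A‖

end

end ActiveSubspace

namespace ActiveSubspace

/-! Conditionally on `Ŷ = y`, `ĝ(y)` is the mean of `f` over the slice `Ŵ₁ y + range Ŵ₂`, so the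
error is a conditional variance averaged over `y`. Everything rests on a Poincaré inequality on the
slices whose constant does not depend on `y`, `k` or `Ŵ`. It bounds the error by `C ∫ |Ŵ₂ᵀ∇f|² ρ = C
∑ λᵢ |Ŵ₂ᵀ wᵢ|²`, where `wᵢ` are the columns of `W`. Here `|Ŵ₂ᵀ wᵢ| ≤ 1` always, and for `i ≤ k` it
is `|Ŵ₂ᵀ(wᵢ - ŵᵢ)| ≤ ε` (`sum_eigen_lastCols_le`).

For the Poincaré inequality (`lintegral_slice_sub_sq_le`), the variance is bounded by the mean of
`|f(z') - f(z)|²`, and the increment by the gradient along the segment from `z` to `z' = z + v`.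
After Cauchy–Schwarz with a weight `a(τ)` and the substitution `u = z + τv`, what is needed of the
slice density `q` is `∫ |v|² q(u - τv) q(u + (1-τ)v) dv ≤ a(τ)² q(u) ∫ q`; the resulting constant is
`(∫ a)²`. For a uniform density convexity and boundedness give a constant `a`. For the Gaussian,
completing the square gives `a(τ)²` of order `1/(τ(1-τ))`, whose square root is integrable.

Since only partial derivatives are assumed, `f` need not be differentiable along an oblique segment.
`ae_sub_eq_integral` recovers the fundamental theorem on almost every segment: it holds exactly on
axis-parallel staircases, and these converge to the segment by continuity of translations in `L¹`.
-/

/-! ### Linear algebra: eigenvectors seen from a perturbed orthogonal frame. -/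

theorem sum_sq_col_le_spectralNorm {n : ℕ} (D : Matrix (Fin n) (Fin n) ℝ) (i : Fin n) :
    ∑ a, D a i ^ 2 ≤ spectralNorm D ^ 2 := by
  have h := (Matrix.toEuclideanCLM (n := Fin n) (𝕜 := ℝ) D).le_opNorm (EuclideanSpace.single i 1)
  rw [PiLp.norm_single, norm_one, mul_one] at h
  have h2 := pow_le_pow_left₀ (norm_nonneg _) h 2
  rw [EuclideanSpace.norm_sq_eq] at h2
  simpa [spectralNorm, Matrix.ofLp_toEuclideanCLM] using h2

theorem sum_sq_transpose_mulVec {n : ℕ} {Q : Matrix (Fin n) (Fin n) ℝ}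
    (hQ : Q ∈ Matrix.orthogonalGroup (Fin n) ℝ) (v : Fin n → ℝ) :
    ∑ j, (Qᵀ *ᵥ v) j ^ 2 = ∑ j, v j ^ 2 := by
  have h : (Qᵀ *ᵥ v) ⬝ᵥ (Qᵀ *ᵥ v) = v ⬝ᵥ v := by
    rw [Matrix.dotProduct_mulVec, ← Matrix.mulVec_transpose, Matrix.transpose_transpose,
      Matrix.mulVec_mulVec, (Matrix.mem_orthogonalGroup_iff _ _).1 hQ, Matrix.one_mulVec]
  simpa [dotProduct, sq] using h

theorem sum_lastCols_sq_le {n k : ℕ} (hk : k < n) {Q : Matrix (Fin n) (Fin n) ℝ}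
    (hQ : Q ∈ Matrix.orthogonalGroup (Fin n) ℝ) (v : Fin n → ℝ) :
    ∑ j, ((lastCols hk Q)ᵀ *ᵥ v) j ^ 2 ≤ ∑ j, v j ^ 2 := by
  rw [← sum_sq_transpose_mulVec hQ v]
  let e : Fin (n - k) ↪ Fin n :=
    ⟨fun j => ⟨k + j, by have := j.isLt; omega⟩, fun a b h => by
      simpa [Fin.ext_iff] using h⟩
  have := Finset.sum_map Finset.univ e (fun j => (Qᵀ *ᵥ v) j ^ 2)
  calc _ = ∑ j ∈ Finset.univ.map e, (Qᵀ *ᵥ v) j ^ 2 := by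
        rw [this]; rfl
    _ ≤ _ := Finset.sum_le_univ_sum_of_nonneg fun j => sq_nonneg _

theorem lastCols_transpose_mulVec_col {n k : ℕ} (hk : k < n) {Q : Matrix (Fin n) (Fin n) ℝ}
    (hQ : Q ∈ Matrix.orthogonalGroup (Fin n) ℝ) {i : Fin n} (hi : (i : ℕ) < k) :
    (lastCols hk Q)ᵀ *ᵥ (fun a => Q a i) = 0 := by
  ext j
  have h := congrFun (congrFun ((Matrix.mem_orthogonalGroup_iff' _ _).1 hQ)
    ⟨k + j, by have := j.isLt; omega⟩) i
  rw [Matrix.one_apply_ne (by intro h; simp [Fin.ext_iff] at h; omega)] at h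
  simpa [Matrix.mul_apply, Matrix.mulVec, dotProduct, lastCols] using h

/-- The energy of an eigendecomposition in the directions of the last columns of a nearby
orthogonal matrix. -/
theorem sum_eigen_lastCols_le {n k : ℕ} (hk : k < n) {W Q : Matrix (Fin n) (Fin n) ℝ}
    (hW : W ∈ Matrix.orthogonalGroup (Fin n) ℝ) (hQ : Q ∈ Matrix.orthogonalGroup (Fin n) ℝ)
    {l : Fin n → ℝ} (hl : ∀ i, 0 ≤ l i) {ε : ℝ} (hε : 0 ≤ ε) (h : spectralNorm (W - Q) ≤ ε) :
    ∑ i, l i * ∑ j, ((lastCols hk Q)ᵀ *ᵥ fun a => W a i) j ^ 2 ≤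
      (ε * √(∑ i ∈ Finset.univ.filter (fun i : Fin n => (i : ℕ) < k), l i) +
            √(∑ i ∈ Finset.univ.filter (fun i : Fin n => k ≤ (i : ℕ)), l i)) ^ 2 := by
  have h1 : ∀ i : Fin n, ∑ j, ((lastCols hk Q)ᵀ *ᵥ fun a => W a i) j ^ 2 ≤ 1 := by
    intro i
    refine (sum_lastCols_sq_le hk hQ _).trans_eq ?_
    have := congrFun (congrFun ((Matrix.mem_orthogonalGroup_iff' _ _).1 hW) i) i
    simpa [Matrix.mul_apply, sq] using this
  -- For `i < k` the column `i` of `Q` is orthogonal to its last columns, so it can be subtracted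
  -- for free; what remains is a column of `W - Q`.
  have h2 : ∀ i : Fin n, (i : ℕ) < k →
      ∑ j, ((lastCols hk Q)ᵀ *ᵥ fun a => W a i) j ^ 2 ≤ ε ^ 2 := by
    intro i hi
    have : ((lastCols hk Q)ᵀ *ᵥ fun a => W a i) = (lastCols hk Q)ᵀ *ᵥ fun a => (W - Q) a i := by
      have e : (fun a => (W - Q) a i) = (fun a => W a i) - fun a => Q a i := by ext; simp
      rw [e, Matrix.mulVec_sub, lastCols_transpose_mulVec_col hk hQ hi, sub_zero]
    rw [this]
    exact (sum_lastCols_sq_le hk hQ _).trans ((sum_sq_col_le_spectralNorm _ i).trans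
      (pow_le_pow_left₀ (norm_nonneg _) h 2))
  set A := ∑ i ∈ Finset.univ.filter (fun i : Fin n => (i : ℕ) < k), l i with hA
  set B := ∑ i ∈ Finset.univ.filter (fun i : Fin n => k ≤ (i : ℕ)), l i with hB
  have hA0 : 0 ≤ A := Finset.sum_nonneg fun i _ => hl i
  have hB0 : 0 ≤ B := Finset.sum_nonneg fun i _ => hl i
  have key : ∑ i, l i * ∑ j, ((lastCols hk Q)ᵀ *ᵥ fun a => W a i) j ^ 2 ≤ ε ^ 2 * A + B := by
    rw [← Finset.sum_filter_add_sum_filter_not Finset.univ (fun i : Fin n => (i : ℕ) < k)]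
    refine add_le_add ?_ ?_
    · rw [hA, Finset.mul_sum]
      refine Finset.sum_le_sum fun i hi => ?_
      rw [mul_comm]
      exact mul_le_mul_of_nonneg_right (h2 i (Finset.mem_filter.1 hi).2) (hl i)
    · simp only [not_lt]
      refine Finset.sum_le_sum fun i hi => ?_
      exact mul_le_of_le_one_right (hl i) (h1 i)
  refine key.trans ?_
  -- The square exceeds `ε² A + B` by the nonnegative cross term `2 ε √A √B`.
  nlinarith [Real.sq_sqrt hA0, Real.sq_sqrt hB0,
    mul_nonneg hε (mul_nonneg (Real.sqrt_nonneg A) (Real.sqrt_nonneg B))]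

/-! ### The orthogonal coordinates `(y, z)`. -/

/-- The point `W₁ y + W₂ z` as `W` applied to the concatenation of `y` and `z`. -/
theorem point_eq_mulVec {n k : ℕ} (hk : k < n) (Q : Matrix (Fin n) (Fin n) ℝ)
    (y : Fin k → ℝ) (z : Fin (n - k) → ℝ) :
    point hk Q y z = Q *ᵥ fun i : Fin n =>
      Sum.elim y z ((finSumFinEquiv.trans (finCongr (Nat.add_sub_of_le hk.le))).symm i) := by
  ext a
  simp only [point, Matrix.mulVec, dotProduct, Pi.add_apply]
  rw [← Equiv.sum_comp (finSumFinEquiv.trans (finCongr (Nat.add_sub_of_le hk.le)))]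
  simp [firstCols, lastCols]
  rfl

theorem measurePreserving_orthogonal {n : ℕ} {Q : Matrix (Fin n) (Fin n) ℝ}
    (hQ : Q ∈ Matrix.orthogonalGroup (Fin n) ℝ) :
    MeasurePreserving (fun x : Fin n → ℝ => Q *ᵥ x) := by
  have hd : Q.det * Q.det = 1 := by
    have := congrArg Matrix.det ((Matrix.mem_orthogonalGroup_iff _ _).1 hQ)
    simpa using this
  have h0 : Q.det ≠ 0 := by intro h; simp [h] at hd
  refine ⟨by fun_prop, ?_⟩
  have := Real.map_matrix_volume_pi_eq_smul_volume_pi h0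
  have h1 : |Q.det⁻¹| = 1 := by
    have : |Q.det| * |Q.det| = 1 := by rw [← abs_mul, hd, abs_one]
    rw [abs_inv]
    have h3 : |Q.det| = 1 := by nlinarith [abs_nonneg Q.det]
    rw [h3, inv_one]
  rw [h1, ENNReal.ofReal_one, one_smul] at this
  exact this

theorem measurePreserving_point {n k : ℕ} (hk : k < n) {Q : Matrix (Fin n) (Fin n) ℝ}
    (hQ : Q ∈ Matrix.orthogonalGroup (Fin n) ℝ) :
    MeasurePreserving (fun p : (Fin k → ℝ) × (Fin (n - k) → ℝ) => point hk Q p.1 p.2)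
      (volume.prod volume) volume := by
  have h1 := volume_measurePreserving_sumPiEquivProdPi_symm (fun _ : Fin k ⊕ Fin (n - k) => ℝ)
  have h2 := volume_measurePreserving_piCongrLeft (fun _ : Fin n => ℝ)
    (finSumFinEquiv.trans (finCongr (Nat.add_sub_of_le hk.le)) : Fin k ⊕ Fin (n - k) ≃ Fin n)
  have h3 := (measurePreserving_orthogonal hQ).comp (h2.comp h1)
  convert! h3 using 1
  ext1 p
  simp only [point_eq_mulVec, Function.comp]
  congr 1
  ext i
  obtain ⟨j, rfl⟩ := (finSumFinEquiv.trans (finCongr (Nat.add_sub_of_le hk.le)) :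
    Fin k ⊕ Fin (n - k) ≃ Fin n).surjective i
  rw [Equiv.symm_apply_apply]
  erw [MeasurableEquiv.piCongrLeft_apply_apply]
  cases j <;> rfl

theorem firstCols_transpose_mulVec_point {n k : ℕ} (hk : k < n) {Q : Matrix (Fin n) (Fin n) ℝ}
    (hQ : Q ∈ Matrix.orthogonalGroup (Fin n) ℝ) (y : Fin k → ℝ) (z : Fin (n - k) → ℝ) :
    (firstCols hk Q)ᵀ *ᵥ point hk Q y z = y := by
  have h := (Matrix.mem_orthogonalGroup_iff' _ _).1 hQ
  have h1 : (firstCols hk Q)ᵀ * firstCols hk Q = 1 := by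
    ext i j
    have := congrFun (congrFun h ⟨i, i.isLt.trans hk⟩) ⟨j, j.isLt.trans hk⟩
    simpa [Matrix.mul_apply, firstCols, Matrix.one_apply, Fin.ext_iff] using this
  have h2 : (firstCols hk Q)ᵀ * lastCols hk Q = 0 := by
    ext i j
    have := congrFun (congrFun h ⟨i, i.isLt.trans hk⟩) ⟨k + j, by have := j.isLt; omega⟩
    rw [Matrix.one_apply_ne (by intro h; simp [Fin.ext_iff] at h; omega)] at this
    simpa [Matrix.mul_apply, firstCols, lastCols] using this
  rw [point, Matrix.mulVec_add, Matrix.mulVec_mulVec, Matrix.mulVec_mulVec, h1, h2]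
  simp

theorem sum_sq_point {n k : ℕ} (hk : k < n) {Q : Matrix (Fin n) (Fin n) ℝ}
    (hQ : Q ∈ Matrix.orthogonalGroup (Fin n) ℝ) (y : Fin k → ℝ) (z : Fin (n - k) → ℝ) :
    ∑ i, point hk Q y z i ^ 2 = ∑ i, y i ^ 2 + ∑ i, z i ^ 2 := by
  rw [point_eq_mulVec, ← sum_sq_transpose_mulVec hQ, Matrix.mulVec_mulVec,
    (Matrix.mem_orthogonalGroup_iff' _ _).1 hQ, Matrix.one_mulVec,
    ← Equiv.sum_comp (finSumFinEquiv.trans (finCongr (Nat.add_sub_of_le hk.le)))]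
  simp

/-! ### The fundamental theorem of calculus along almost every segment. -/

open Filter Topology Set

/-- Translations act continuously on `L¹`. -/
theorem tendsto_lintegral_translate {n : ℕ} {g : (Fin n → ℝ) → ℝ} (hg : Integrable g) :
    Tendsto (fun h : Fin n → ℝ => ∫⁻ x, ‖g (x + h) - g x‖ₑ) (𝓝 0) (𝓝 0) := by
  have hmem : MemLp g 1 volume := memLp_one_iff_integrable.2 hg
  have : Fact ((1 : ENNReal) ≤ 1) := ⟨le_rfl⟩
  have : Fact ((1 : ENNReal) ≠ ⊤) := ⟨ENNReal.one_ne_top⟩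
  have hc : Continuous fun h : Fin n → ℝ => DomAddAct.mk h +ᵥ hmem.toLp g :=
    (DomAddAct.continuous_mk).vadd continuous_const
  have ht := hc.tendsto 0
  rw [tendsto_iff_edist_tendsto_0] at ht
  refine ht.congr fun h => ?_
  rw [DomAddAct.mk_zero, zero_vadd, DomAddAct.mk_vadd_toLp, Lp.edist_toLp_toLp,
    eLpNorm_one_eq_lintegral_enorm]
  simp [add_comm]

/-- Tonelli and translation invariance: averaging over the starting point removes the path. Hence an
integrable function is integrable along almost every translate of any measurable path. -/
theorem lintegral_path_translate {n : ℕ} {g : (Fin n → ℝ) → ENNReal} (hg : Measurable g)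
    {ψ : ℝ → Fin n → ℝ} (hψ : Measurable ψ) (s : Set ℝ) :
    ∫⁻ x, ∫⁻ τ in s, g (x + ψ τ) = (∫⁻ x, g x) * volume s := by
  rw [lintegral_lintegral_swap (by fun_prop)]
  simp_rw [lintegral_add_right_eq_self g]
  simp

theorem ae_integrableOn_path {n : ℕ} {g : (Fin n → ℝ) → ℝ} (hgm : Measurable g)
    (hg : Integrable g) {ψ : ℝ → Fin n → ℝ} (hψ : Measurable ψ) :
    ∀ᵐ x, IntegrableOn (fun τ => g (x + ψ τ)) (Ioc 0 1) := by
  have h := lintegral_path_translate hgm.enorm hψ (Ioc 0 1)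
  have hlt : ∫⁻ x, ∫⁻ τ in Ioc (0 : ℝ) 1, ‖g (x + ψ τ)‖ₑ < ⊤ := by
    rw [h]
    refine ENNReal.mul_lt_top hg.2 ?_
    simp
  have hm : Measurable fun x => ∫⁻ τ in Ioc (0 : ℝ) 1, ‖g (x + ψ τ)‖ₑ :=
    Measurable.lintegral_prod_right' (f := fun p : (Fin n → ℝ) × ℝ => ‖g (p.1 + ψ p.2)‖ₑ)
      (by fun_prop)
  filter_upwards [ae_lt_top hm hlt.ne] with x hx
  exact ⟨(hgm.comp (measurable_const.add hψ)).aestronglyMeasurable, hx⟩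

/-- The fundamental theorem of calculus along a segment in a convex set. -/
theorem integral_lineDeriv_segment {n : ℕ} {U : Set (Fin n → ℝ)} (hU : Convex ℝ U)
    {F G : (Fin n → ℝ) → ℝ} {e : Fin n → ℝ}
    (hF : ∀ x ∈ U, HasDerivAt (fun t : ℝ => F (x + t • e)) (G x) 0)
    {p : Fin n → ℝ} {a b c : ℝ} (hab : a ≤ b) (hp : p ∈ U) (hq : p + (b - a) • c • e ∈ U)
    (hi : IntervalIntegrable (fun τ => G (p + (τ - a) • c • e)) volume a b) :
    F (p + (b - a) • c • e) - F p = c * ∫ τ in a..b, G (p + (τ - a) • c • e) := by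
  have hmem : ∀ τ ∈ Icc a b, p + (τ - a) • c • e ∈ U := by
    intro τ hτ
    rcases hab.eq_or_lt with rfl | hlt
    · have : τ = a := le_antisymm hτ.2 hτ.1
      simpa [this] using hp
    · have := hU.add_smul_sub_mem hp hq (t := (τ - a) / (b - a))
        ⟨div_nonneg (by linarith [hτ.1]) (by linarith),
          div_le_one_of_le₀ (by linarith [hτ.2]) (by linarith)⟩
      rw [add_sub_cancel_left, smul_smul, div_mul_cancel₀ _ (by linarith)] at this
      exact this
  have hd : ∀ τ ∈ uIcc a b, HasDerivAt (fun τ => F (p + (τ - a) • c • e))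
      (c * G (p + (τ - a) • c • e)) τ := by
    intro τ hτ
    rw [uIcc_of_le hab] at hτ
    have h1 := hF _ (hmem τ hτ)
    have h2 : HasDerivAt (fun σ : ℝ => (σ - τ) * c) c τ := by
      simpa using ((hasDerivAt_id τ).sub_const τ).mul_const c
    have h3 := HasDerivAt.comp_of_eq (h₂ := fun t : ℝ => F (p + (τ - a) • c • e + t • e)) τ h1 h2
      (by simp)
    rw [mul_comm]
    refine h3.congr_of_eventuallyEq (Eventually.of_forall fun σ => ?_)
    simp only [Function.comp]
    congr 1
    rw [add_assoc]
    congr 1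
    simp only [smul_smul, ← add_smul]
    congr 1
    ring
  -- The derivative exists at every point of the segment, so its integrability suffices; no
  -- continuity is needed.
  have := intervalIntegral.integral_eq_sub_of_hasDerivAt hd (hi.const_mul c)
  rw [intervalIntegral.integral_const_mul] at this
  rw [this]
  simp

/-- The first `m` coordinates of `w`, the others being replaced by `0`. -/
noncomputable def trunc {n : ℕ} (w : Fin n → ℝ) (m : ℕ) : Fin n → ℝ := fun a => if (a : ℕ) < m then w a else 0

theorem trunc_zero {n : ℕ} (w : Fin n → ℝ) : trunc w 0 = 0 := by
  ext a; simp [trunc]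

theorem trunc_self {n : ℕ} (w : Fin n → ℝ) : trunc w n = w := by
  ext a; simp [trunc]

theorem trunc_succ {n : ℕ} (w : Fin n → ℝ) (i : Fin n) :
    trunc w (i + 1) = trunc w i + w i • Pi.single i 1 := by
  ext a
  rcases lt_trichotomy a i with h | h | h
  · have h1 : (a : ℕ) < i := h
    simp [trunc, h1, h1.trans (Nat.lt_succ_self _), h.ne]
  · simp [trunc, h]
  · have h1 : (i : ℕ) < a := h
    simp [trunc, h1.not_gt, h.ne', show ¬ (a : ℕ) < i + 1 by omega]

theorem norm_trunc_le {n : ℕ} (w : Fin n → ℝ) (m : ℕ) : ‖trunc w m‖ ≤ ‖w‖ := by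
  refine (pi_norm_le_iff_of_nonneg (norm_nonneg _)).2 fun a => ?_
  unfold trunc
  split_ifs
  · exact norm_le_pi_norm w a
  · simp

/-- The staircase path along `w` on the `j`-th of `N` subintervals, moving in direction `i`. -/
noncomputable def stair {n : ℕ} (w : Fin n → ℝ) (N j : ℕ) (i : Fin n) (τ : ℝ) : Fin n → ℝ :=
  ((j : ℝ) / N) • w + (1 / (N : ℝ)) • trunc w i + (τ - (j : ℝ) / N) • w i • Pi.single i 1

theorem measurable_stair {n : ℕ} (w : Fin n → ℝ) (N j : ℕ) (i : Fin n) :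
    Measurable (stair w N j i) := by
  unfold stair; fun_prop

/-- All coordinate moves of block `j` share the same interval of `τ`. Compared with `τ • w`, the
coordinates already moved are ahead and the pending ones behind, by at most `|w a| / N`; the moving
one agrees exactly. -/
theorem norm_stair_sub_le {n : ℕ} (w : Fin n → ℝ) {N j : ℕ} (i : Fin n) {τ : ℝ}
    (hτ : τ ∈ Ioc ((j : ℝ) / N) ((j + 1 : ℕ) / N)) : ‖stair w N j i τ - τ • w‖ ≤ 1 / N * ‖w‖ := by
  have h1 : 0 ≤ τ - (j : ℝ) / N := by linarith [hτ.1]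
  have h2 : τ - (j : ℝ) / N ≤ 1 / N := by
    have := hτ.2
    push_cast [add_div] at this
    linarith
  refine (pi_norm_le_iff_of_nonneg (by positivity)).2 fun a => ?_
  have ha := norm_le_pi_norm w a
  have hN : (0 : ℝ) ≤ 1 / N := by positivity
  suffices h : ∃ c : ℝ, |c| ≤ 1 / N ∧ (stair w N j i τ - τ • w) a = c * w a by
    obtain ⟨c, hc, h⟩ := h
    rw [h, norm_mul, Real.norm_eq_abs]
    exact mul_le_mul hc ha (norm_nonneg _) hN
  rcases lt_trichotomy a i with h | h | h
  · have h' : (a : ℕ) < i := h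
    refine ⟨1 / N - (τ - j / N), by rw [abs_le]; constructor <;> linarith, ?_⟩
    simp [stair, trunc, h', h.ne]; ring
  · refine ⟨0, by simp, ?_⟩
    simp [stair, trunc, h]; ring
  · have h' : ¬ (a : ℕ) < i := not_lt.2 (le_of_lt h)
    refine ⟨-(τ - j / N), by rw [abs_le]; constructor <;> linarith, ?_⟩
    simp [stair, trunc, h', h.ne']; ring

/-- The `L¹`-type distance between the staircase path and the straight path. -/
noncomputable def stairError {n : ℕ} (g : Fin n → (Fin n → ℝ) → ℝ) (w : Fin n → ℝ) (N : ℕ) (x : Fin n → ℝ) :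
    ENNReal :=
  ∑ j ∈ Finset.range N, ∑ i, ‖w i‖ₑ * ∫⁻ τ in Ioc ((j : ℝ) / N) ((j + 1 : ℕ) / N),
    ‖g i (x + stair w N j i τ) - g i (x + τ • w)‖ₑ

theorem measurable_stairError {n : ℕ} {g : Fin n → (Fin n → ℝ) → ℝ} (hgm : ∀ i, Measurable (g i))
    (w : Fin n → ℝ) (N : ℕ) : Measurable (stairError g w N) := by
  unfold stairError
  refine Finset.measurable_sum _ fun j _ => Finset.measurable_sum _ fun i _ => ?_
  refine Measurable.const_mul ?_ _
  have := measurable_stair w N j i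
  have := hgm i
  exact Measurable.lintegral_prod_right' (f := fun p : (Fin n → ℝ) × ℝ =>
    ‖g i (p.1 + stair w N j i p.2) - g i (p.1 + p.2 • w)‖ₑ) (by fun_prop)

theorem tendsto_lintegral_stairError {n : ℕ} {g : Fin n → (Fin n → ℝ) → ℝ}
    (hgm : ∀ i, Measurable (g i)) (hg : ∀ i, Integrable (g i)) (w : Fin n → ℝ) :
    Tendsto (fun N => ∫⁻ x, stairError g w N x) atTop (𝓝 0) := by
  -- Once `‖w‖ / N` is below the `L¹` translation modulus for `η`, each of the `N` blocks, of length
  -- `1 / N`, contributes at most `(∑ ‖w i‖ₑ) η / N`.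
  have hbound : ∀ η : ENNReal, 0 < η → ∀ᶠ N : ℕ in atTop,
      ∫⁻ x, stairError g w N x ≤ (∑ i, ‖w i‖ₑ) * η := by
    intro η hη
    have h1 : ∀ᶠ h : Fin n → ℝ in 𝓝 0, ∀ i, ∫⁻ x, ‖g i (x + h) - g i x‖ₑ < η :=
      eventually_all.2 fun i => (tendsto_lintegral_translate (hg i)).eventually_lt_const hη
    obtain ⟨δ, hδ, h2⟩ := Metric.eventually_nhds_iff.1 h1
    have h3 : Tendsto (fun N : ℕ => 1 / (N : ℝ) * ‖w‖) atTop (𝓝 0) := by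
      simpa using tendsto_one_div_atTop_nhds_zero_nat.mul_const ‖w‖
    filter_upwards [h3.eventually_lt_const hδ, eventually_gt_atTop 0] with N hN hN0
    unfold stairError
    rw [lintegral_finsetSum]
    swap
    · intro j _
      refine Finset.measurable_sum _ fun i _ => Measurable.const_mul ?_ _
      have := measurable_stair w N j i
      have := hgm i
      exact Measurable.lintegral_prod_right' (f := fun p : (Fin n → ℝ) × ℝ =>
        ‖g i (p.1 + stair w N j i p.2) - g i (p.1 + p.2 • w)‖ₑ) (by fun_prop)
    have h4 : ∀ j ∈ Finset.range N, ∫⁻ x, ∑ i, ‖w i‖ₑ *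
        ∫⁻ τ in Ioc ((j : ℝ) / N) ((j + 1 : ℕ) / N),
          ‖g i (x + stair w N j i τ) - g i (x + τ • w)‖ₑ ≤
        (∑ i, ‖w i‖ₑ) * η * ENNReal.ofReal (1 / N) := by
      intro j _
      have hmeas : ∀ i, Measurable fun p : (Fin n → ℝ) × ℝ =>
          ‖g i (p.1 + stair w N j i p.2) - g i (p.1 + p.2 • w)‖ₑ := by
        intro i
        have := measurable_stair w N j i
        have := hgm i
        fun_prop
      rw [lintegral_finsetSum _ fun i _ => (hmeas i).lintegral_prod_right'.const_mul _,
        Finset.sum_mul, Finset.sum_mul]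
      refine Finset.sum_le_sum fun i _ => ?_
      rw [lintegral_const_mul _ (hmeas i).lintegral_prod_right', mul_assoc]
      gcongr
      rw [lintegral_lintegral_swap (hmeas i).aemeasurable]
      calc _ ≤ ∫⁻ τ in Ioc ((j : ℝ) / N) ((j + 1 : ℕ) / N), η := by
            refine setLIntegral_mono measurable_const fun τ hτ => ?_
            have h5 := h2 (y := stair w N j i τ - τ • w) (by
              rw [dist_zero_right]; exact (norm_stair_sub_le w i hτ).trans_lt hN) i
            rw [← lintegral_add_right_eq_self _ (τ • w)] at h5
            refine le_trans (le_of_eq ?_) h5.le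
            refine lintegral_congr fun x => ?_
            congr 3
            abel
        _ = _ := by
            rw [setLIntegral_const, Real.volume_Ioc]
            congr 2
            push_cast
            ring
    refine (Finset.sum_le_sum h4).trans_eq ?_
    rw [Finset.sum_const, Finset.card_range, nsmul_eq_mul, ← mul_assoc, mul_comm (N : ENNReal),
      mul_assoc, ← ENNReal.ofReal_natCast, ← ENNReal.ofReal_mul (by positivity),
      mul_one_div_cancel (by positivity), ENNReal.ofReal_one, mul_one]
  rw [ENNReal.tendsto_nhds_zero]
  intro η hη
  have hw : (∑ i, ‖w i‖ₑ) ≠ ⊤ := by simp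
  rcases eq_or_ne η ⊤ with rfl | htop
  · simp
  -- The `+ 1` avoids a zero denominator when `w = 0`.
  · filter_upwards [hbound (η / ((∑ i, ‖w i‖ₑ) + 1))
      (ENNReal.div_pos hη.ne' (by simp [hw]))] with N hN
    refine hN.trans ?_
    calc _ ≤ ((∑ i, ‖w i‖ₑ) + 1) * (η / ((∑ i, ‖w i‖ₑ) + 1)) := by gcongr; exact le_self_add
      _ ≤ η := ENNReal.mul_div_le

/-- The increment of `F` telescopes exactly over the axis-parallel steps, where the `g i` are true
derivatives. The error is only that of evaluating `g i` on the staircase instead of on the segment.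
-/
theorem enorm_sub_integral_le_stairError {n : ℕ} {U : Set (Fin n → ℝ)} (hU : Convex ℝ U)
    {F : (Fin n → ℝ) → ℝ} {g : Fin n → (Fin n → ℝ) → ℝ}
    (hF : ∀ x ∈ U, ∀ i, HasDerivAt (fun t : ℝ => F (x + t • Pi.single i 1)) (g i x) 0)
    {w x : Fin n → ℝ} {N : ℕ} (hN : 0 < N)
    (hmem : ∀ j < N, ∀ m ≤ n, x + ((j : ℝ) / N) • w + (1 / (N : ℝ)) • trunc w m ∈ U)
    (hi : ∀ i, ∀ j < N, IntegrableOn (fun τ => g i (x + stair w N j i τ)) (Ioc 0 1))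
    (hw : ∀ i, IntegrableOn (fun τ : ℝ => g i (x + τ • w)) (Ioc 0 1)) :
    ‖F (x + w) - F x - ∫ τ in (0 : ℝ)..1, ∑ i, w i * g i (x + τ • w)‖ₑ ≤ stairError g w N x := by
  have hN' : (0 : ℝ) < N := by exact_mod_cast hN
  have hle : ∀ j : ℕ, (j : ℝ) / N ≤ ((j + 1 : ℕ) : ℝ) / N := fun j => by
    gcongr; exact Nat.le_succ j
  have hsub : ∀ j < N, uIoc ((j : ℝ) / N) (((j + 1 : ℕ) : ℝ) / N) ⊆ Ioc 0 1 := by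
    intro j hj
    rw [uIoc_of_le (hle j)]
    refine Ioc_subset_Ioc (by positivity) ?_
    rw [div_le_one hN']
    exact_mod_cast hj
  have hi' : ∀ i, ∀ j < N, IntervalIntegrable (fun τ => g i (x + stair w N j i τ)) volume
      ((j : ℝ) / N) ((j + 1 : ℕ) / N) := fun i j hj =>
    intervalIntegrable_iff.2 ((hi i j hj).mono_set (hsub j hj))
  have hw' : ∀ i, ∀ j < N, IntervalIntegrable (fun τ : ℝ => g i (x + τ • w)) volume
      ((j : ℝ) / N) ((j + 1 : ℕ) / N) := fun i j hj =>
    intervalIntegrable_iff.2 ((hw i).mono_set (hsub j hj))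
  have hstep : ∀ j < N, F (x + (((j + 1 : ℕ) : ℝ) / N) • w) - F (x + ((j : ℝ) / N) • w) =
      ∑ i, w i * ∫ τ in ((j : ℝ) / N)..((j + 1 : ℕ) / N), g i (x + stair w N j i τ) := by
    intro j hj
    have hdiff : ((j + 1 : ℕ) : ℝ) / N - (j : ℝ) / N = 1 / N := by push_cast; ring
    have h1 : ∀ i : Fin n, w i * ∫ τ in ((j : ℝ) / N)..((j + 1 : ℕ) / N), g i (x + stair w N j i τ)
        = F (x + ((j : ℝ) / N) • w + (1 / (N : ℝ)) • trunc w (i + 1)) -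
          F (x + ((j : ℝ) / N) • w + (1 / (N : ℝ)) • trunc w i) := by
      intro i
      have e1 : ∀ τ, x + stair w N j i τ = x + ((j : ℝ) / N) • w + (1 / (N : ℝ)) • trunc w i +
          (τ - (j : ℝ) / N) • w i • Pi.single i 1 := fun τ => by
        simp only [stair, add_assoc]
      have e2 : x + ((j : ℝ) / N) • w + (1 / (N : ℝ)) • trunc w (i + 1) =
          x + ((j : ℝ) / N) • w + (1 / (N : ℝ)) • trunc w i +
          (((j + 1 : ℕ) : ℝ) / N - (j : ℝ) / N) • w i • Pi.single i 1 := by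
        rw [hdiff, trunc_succ, smul_add, add_assoc _ (_ • trunc w i)]
      have hint := hi' i j hj
      simp only [e1] at hint ⊢
      rw [e2, integral_lineDeriv_segment hU (fun y hy => hF y hy i) (hle j)
        (hmem j hj i i.isLt.le) (by rw [← e2]; exact hmem j hj (i + 1) i.isLt) hint]
    simp_rw [h1]
    rw [Fin.sum_univ_eq_sum_range (fun m =>
      F (x + ((j : ℝ) / N) • w + (1 / (N : ℝ)) • trunc w (m + 1)) -
          F (x + ((j : ℝ) / N) • w + (1 / (N : ℝ)) • trunc w m)),
      Finset.sum_range_sub (fun m => F (x + ((j : ℝ) / N) • w + (1 / (N : ℝ)) • trunc w m)),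
      trunc_zero, trunc_self, smul_zero, add_zero, add_assoc x, ← add_smul]
    congr 4
    push_cast
    ring
  have htel : F (x + w) - F x = ∑ j ∈ Finset.range N,
      (F (x + (((j + 1 : ℕ) : ℝ) / N) • w) - F (x + ((j : ℝ) / N) • w)) := by
    rw [Finset.sum_range_sub (fun j : ℕ => F (x + ((j : ℝ) / N) • w)), div_self hN'.ne']
    simp
  have hint : ∫ τ in (0 : ℝ)..1, ∑ i, w i * g i (x + τ • w) = ∑ j ∈ Finset.range N,
      ∑ i, w i * ∫ τ in ((j : ℝ) / N)..((j + 1 : ℕ) / N), g i (x + τ • w) := by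
    have := intervalIntegral.sum_integral_adjacent_intervals (μ := volume) (n := N)
      (a := fun j : ℕ => (j : ℝ) / N) (f := fun τ => ∑ i, w i * g i (x + τ • w))
      (fun j hj => by
        have := IntervalIntegrable.sum Finset.univ fun i _ => (hw' i j hj).const_mul (w i)
        convert! this using 1
        ext τ
        simp)
    rw [div_self hN'.ne'] at this
    simp only [Nat.cast_zero, zero_div] at this
    rw [← this]
    refine Finset.sum_congr rfl fun j hj => ?_
    rw [intervalIntegral.integral_finsetSum fun i _ =>
      (hw' i j (Finset.mem_range.1 hj)).const_mul _]
    simp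
  rw [htel, hint, ← Finset.sum_sub_distrib]
  refine (enorm_sum_le _ _).trans (Finset.sum_le_sum fun j hj => ?_)
  have hj' := Finset.mem_range.1 hj
  rw [hstep j hj', ← Finset.sum_sub_distrib]
  refine (enorm_sum_le _ _).trans (Finset.sum_le_sum fun i _ => ?_)
  rw [← mul_sub, ← intervalIntegral.integral_sub (hi' i j hj') (hw' i j hj'), enorm_mul,
    intervalIntegral.integral_of_le (hle j)]
  gcongr
  exact enorm_integral_le_lintegral_enorm _

/-- The segment is compact, so `U` contains a neighbourhood of it of fixed width, and the corners of
the staircase lie within `‖w‖ / N` of it. -/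
theorem eventually_stair_mem {n : ℕ} {U : Set (Fin n → ℝ)} (hU : Convex ℝ U) (hUo : IsOpen U)
    {x w : Fin n → ℝ} (hx : x ∈ U) (hxw : x + w ∈ U) :
    ∀ᶠ N : ℕ in atTop, ∀ j < N, ∀ m ≤ n,
      x + ((j : ℝ) / N) • w + (1 / (N : ℝ)) • trunc w m ∈ U := by
  have hseg : segment ℝ x (x + w) ⊆ U := hU.segment_subset hx hxw
  have hcomp : IsCompact (segment ℝ x (x + w)) := by
    rw [segment_eq_image_lineMap]
    exact isCompact_Icc.image AffineMap.lineMap_continuous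
  obtain ⟨δ, hδ, hsub⟩ := hcomp.exists_thickening_subset_open hUo hseg
  have h3 : Tendsto (fun N : ℕ => 1 / (N : ℝ) * ‖w‖) atTop (𝓝 0) := by
    simpa using tendsto_one_div_atTop_nhds_zero_nat.mul_const ‖w‖
  filter_upwards [h3.eventually_lt_const hδ, eventually_gt_atTop 0] with N hN hN0 j hj m _
  have hN' : (0 : ℝ) < N := by exact_mod_cast hN0
  refine hsub (Metric.mem_thickening_iff.2 ⟨x + ((j : ℝ) / N) • w, ?_, ?_⟩)
  · rw [segment_eq_image']
    refine ⟨(j : ℝ) / N, ⟨by positivity, ?_⟩, by simp⟩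
    rw [div_le_one hN']
    exact_mod_cast hj.le
  · rw [dist_eq_norm, add_sub_cancel_left, norm_smul, Real.norm_of_nonneg (by positivity)]
    refine lt_of_le_of_lt ?_ hN
    gcongr
    exact norm_trunc_le w m

/-- A function with integrable partial derivatives on an open convex set satisfies, for every `w`,
the fundamental theorem of calculus along almost every segment parallel to `w`. -/
theorem ae_sub_eq_integral {n : ℕ} {U : Set (Fin n → ℝ)} (hU : Convex ℝ U) (hUo : IsOpen U)
    {F : (Fin n → ℝ) → ℝ} {g : Fin n → (Fin n → ℝ) → ℝ}
    (hgm : ∀ i, Measurable (g i)) (hg : ∀ i, Integrable (g i))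
    (hF : ∀ x ∈ U, ∀ i, HasDerivAt (fun t : ℝ => F (x + t • Pi.single i 1)) (g i x) 0)
    (w : Fin n → ℝ) :
    ∀ᵐ x, x ∈ U → x + w ∈ U →
      F (x + w) - F x = ∫ τ in (0 : ℝ)..1, ∑ i, w i * g i (x + τ • w) := by
  have hi : ∀ᵐ x, ∀ i, ∀ N : ℕ, ∀ j : ℕ,
      IntegrableOn (fun τ => g i (x + stair w N j i τ)) (Ioc 0 1) := by
    simp only [ae_all_iff]
    exact fun i N j => ae_integrableOn_path (hgm i) (hg i) (measurable_stair w N j i)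
  have hw : ∀ᵐ x, ∀ i, IntegrableOn (fun τ : ℝ => g i (x + τ • w)) (Ioc 0 1) := by
    rw [ae_all_iff]
    exact fun i => ae_integrableOn_path (hgm i) (hg i) (by fun_prop)
  -- By Fatou, convergence in mean gives a zero `liminf` almost everywhere. This is enough, as the
  -- quantity to be bounded does not depend on `N`.
  have hlim : ∫⁻ x, liminf (fun N => stairError g w N x) atTop = 0 := by
    refine le_antisymm ?_ zero_le
    refine (lintegral_liminf_le fun N => measurable_stairError hgm w N).trans ?_
    rw [(tendsto_lintegral_stairError hgm hg w).liminf_eq]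
  rw [lintegral_eq_zero_iff (Measurable.liminf fun N => measurable_stairError hgm w N)] at hlim
  filter_upwards [hi, hw, hlim] with x hix hwx hx hxU hxwU
  have hev : ∀ᶠ N : ℕ in atTop,
      ‖F (x + w) - F x - ∫ τ in (0 : ℝ)..1, ∑ i, w i * g i (x + τ • w)‖ₑ ≤ stairError g w N x := by
    filter_upwards [eventually_stair_mem hU hUo hxU hxwU, eventually_gt_atTop 0] with N hN hN0
    exact enorm_sub_integral_le_stairError hU hF hN0 hN (fun i j _ => hix i N j) hwx
  have := le_liminf_of_le (by isBoundedDefault) hev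
  rw [hx] at this
  simpa [sub_eq_zero] using this

/-- Version for functions whose partial derivatives are integrable on bounded parts only. -/
theorem ae_enorm_sub_le_lintegral {n : ℕ} {U : Set (Fin n → ℝ)} (hU : Convex ℝ U) (hUo : IsOpen U)
    {F : (Fin n → ℝ) → ℝ} {g : Fin n → (Fin n → ℝ) → ℝ}
    (hgm : ∀ i, Measurable (g i))
    (hg : ∀ i, ∀ R : ℕ, IntegrableOn (g i) (U ∩ Metric.ball 0 R))
    (hF : ∀ x ∈ U, ∀ i, HasDerivAt (fun t : ℝ => F (x + t • Pi.single i 1)) (g i x) 0)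
    (w : Fin n → ℝ) :
    ∀ᵐ x, x ∈ U → x + w ∈ U →
      ‖F (x + w) - F x‖ₑ ≤ ∫⁻ τ in Ioc (0 : ℝ) 1, ‖∑ i, w i * g i (x + τ • w)‖ₑ := by
  -- Balls keep the set open and convex and make the partial derivatives integrable; any given
  -- segment lies in one of countably many of them.
  have hR : ∀ R : ℕ, Convex ℝ (U ∩ Metric.ball 0 R) := fun R => hU.inter (convex_ball _ _)
  have hRo : ∀ R : ℕ, IsOpen (U ∩ Metric.ball (0 : Fin n → ℝ) R) :=
    fun R => hUo.inter Metric.isOpen_ball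
  have h := fun R : ℕ => ae_sub_eq_integral (hR R) (hRo R)
    (g := fun i => (U ∩ Metric.ball 0 R).indicator (g i))
    (fun i => (hgm i).indicator (hRo R).measurableSet)
    (fun i => (hg i R).integrable_indicator (hRo R).measurableSet)
    (fun x hx i => by rw [indicator_of_mem hx]; exact hF x hx.1 i) w
  filter_upwards [ae_all_iff.2 h] with x hx hxU hxwU
  obtain ⟨R, hRx⟩ := exists_nat_gt (max ‖x‖ ‖x + w‖)
  have hxR : x ∈ U ∩ Metric.ball 0 (R : ℝ) :=
    ⟨hxU, by simpa using (le_max_left _ _).trans_lt hRx⟩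
  have hxwR : x + w ∈ U ∩ Metric.ball 0 (R : ℝ) :=
    ⟨hxwU, by simpa using (le_max_right _ _).trans_lt hRx⟩
  rw [hx R hxR hxwR, intervalIntegral.integral_of_le zero_le_one]
  refine (enorm_integral_le_lintegral_enorm _).trans_eq ?_
  refine setLIntegral_congr_fun measurableSet_Ioc fun τ hτ => ?_
  have hmem : x + τ • w ∈ U ∩ Metric.ball 0 (R : ℝ) := by
    have := (hR R).add_smul_sub_mem hxR hxwR (t := τ) ⟨hτ.1.le, hτ.2⟩
    rwa [add_sub_cancel_left] at this
  simp only [indicator_of_mem hmem]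

/-! ### The Poincaré inequality on slices, from a kernel condition. -/

/-- The Cauchy–Schwarz inequality with a weight. -/
theorem sq_lintegral_le_weighted {α : Type*} [MeasurableSpace α] {μ : Measure α}
    {a f : α → ENNReal} (ha : Measurable a) (hf : Measurable f)
    (ha0 : ∀ᵐ x ∂μ, a x ≠ 0 ∧ a x ≠ ⊤) :
    (∫⁻ x, f x ∂μ) ^ 2 ≤ (∫⁻ x, a x ∂μ) * ∫⁻ x, (a x)⁻¹ * f x ^ 2 ∂μ := by
  have h := ENNReal.lintegral_mul_norm_pow_le (μ := μ) (f := a) (g := fun x => (a x)⁻¹ * f x ^ 2)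
    ha.aemeasurable (by fun_prop) (p := 1 / 2) (q := 1 / 2) (by norm_num) (by norm_num)
    (by norm_num)
  have h1 : ∫⁻ x, f x ∂μ ≤ (∫⁻ x, a x ∂μ) ^ (1 / 2 : ℝ) *
      (∫⁻ x, (a x)⁻¹ * f x ^ 2 ∂μ) ^ (1 / 2 : ℝ) := by
    refine le_trans (le_of_eq ?_) h
    refine lintegral_congr_ae ?_
    filter_upwards [ha0] with x hx
    rw [← ENNReal.mul_rpow_of_nonneg _ _ (by norm_num), ← mul_assoc,
      ENNReal.mul_inv_cancel hx.1 hx.2, one_mul, ← ENNReal.rpow_natCast, ← ENNReal.rpow_mul]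
    norm_num
  calc _ ≤ _ := pow_le_pow_left₀ zero_le h1 2
    _ = _ := by
      rw [mul_pow, ← ENNReal.rpow_natCast, ← ENNReal.rpow_natCast, ← ENNReal.rpow_mul,
        ← ENNReal.rpow_mul]
      norm_num

theorem enorm_sum_mul_sq_le {d : ℕ} (v h : Fin d → ℝ) :
    ‖∑ j, v j * h j‖ₑ ^ 2 ≤ ENNReal.ofReal (∑ j, v j ^ 2) * ENNReal.ofReal (∑ j, h j ^ 2) := by
  rw [← ENNReal.ofReal_mul (Finset.sum_nonneg fun _ _ => sq_nonneg _),
    Real.enorm_eq_ofReal_abs, ← ENNReal.ofReal_pow (abs_nonneg _), sq_abs]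
  exact ENNReal.ofReal_le_ofReal (Finset.sum_mul_sq_le_sq_mul_sq _ _ _)

/-- A Poincaré inequality, in double integral form and integrated over the slices `{y} × ℝᵈ`, for
functions controlled by a vector field `H` along almost all segments in the slices. The kernel
condition `hq` on the weight `q` depends on a function `a` on the unit interval. -/
theorem lintegral_slice_sub_sq_le {Y : Type*} [MeasureSpace Y] [SFinite (volume : Measure Y)]
    {d : ℕ} {q : Y × (Fin d → ℝ) → ENNReal} (hqm : Measurable q)
    {F : Y × (Fin d → ℝ) → ℝ} (hFm : Measurable F)
    {H : Fin d → Y × (Fin d → ℝ) → ℝ} (hHm : ∀ j, Measurable (H j))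
    (hF : ∀ v : Fin d → ℝ, ∀ᵐ p : Y × (Fin d → ℝ), q p ≠ 0 → q (p.1, p.2 + v) ≠ 0 →
      ‖F (p.1, p.2 + v) - F p‖ₑ ≤
        ∫⁻ τ in Ioc (0 : ℝ) 1, ‖∑ j, v j * H j (p.1, p.2 + τ • v)‖ₑ)
    {a : ℝ → ENNReal} (ham : Measurable a) (ha : ∀ τ ∈ Ioo (0 : ℝ) 1, a τ ≠ 0 ∧ a τ ≠ ⊤)
    (hq : ∀ τ ∈ Ioo (0 : ℝ) 1, ∀ y u,
      ∫⁻ v : Fin d → ℝ, ENNReal.ofReal (∑ j, v j ^ 2) *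
        (q (y, u - τ • v) * q (y, u + (1 - τ) • v)) ≤ a τ ^ 2 * (q (y, u) * ∫⁻ z, q (y, z))) :
    ∫⁻ y, (∫⁻ z, q (y, z))⁻¹ *
        ∫⁻ z, ∫⁻ z', ‖F (y, z') - F (y, z)‖ₑ ^ 2 * (q (y, z) * q (y, z')) ≤
      (∫⁻ τ in Ioo (0 : ℝ) 1, a τ) ^ 2 *
        ∫⁻ y, ∫⁻ z, ENNReal.ofReal (∑ j, H j (y, z) ^ 2) * q (y, z) := by
  set m : Y → ENNReal := fun y => ∫⁻ z, q (y, z) with hm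
  have hmm : Measurable m := hqm.lintegral_prod_right'
  set M : ENNReal := ∫⁻ τ in Ioo (0 : ℝ) 1, a τ with hM
  set S : Y × (Fin d → ℝ) → ENNReal := fun p => ENNReal.ofReal (∑ j, H j p ^ 2) with hS
  have hSm : Measurable S := by fun_prop
  set N : (Fin d → ℝ) → ENNReal := fun v => ENNReal.ofReal (∑ j, v j ^ 2) with hN
  have hNm : Measurable N := by fun_prop
  -- translation of the inner variable and change of the order of integration
  have h1 : ∫⁻ y, (m y)⁻¹ *
        ∫⁻ z, ∫⁻ z', ‖F (y, z') - F (y, z)‖ₑ ^ 2 * (q (y, z) * q (y, z')) =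
      ∫⁻ v, ∫⁻ p : Y × (Fin d → ℝ), (m p.1)⁻¹ * (‖F (p.1, p.2 + v) - F p‖ₑ ^ 2 * (q p * q (p.1, p.2 + v))) := by
    rw [lintegral_lintegral_swap (by fun_prop), Measure.volume_eq_prod, lintegral_prod]
    swap
    · refine Measurable.aemeasurable ?_
      refine Measurable.lintegral_prod_right'
        (f := fun r : (Y × (Fin d → ℝ)) × (Fin d → ℝ) => (m r.1.1)⁻¹ *
          (‖F (r.1.1, r.1.2 + r.2) - F r.1‖ₑ ^ 2 * (q r.1 * q (r.1.1, r.1.2 + r.2)))) ?_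
      fun_prop
    refine lintegral_congr fun y => ?_
    rw [← lintegral_const_mul]
    swap
    · refine Measurable.lintegral_prod_right' (f := fun r : (Fin d → ℝ) × (Fin d → ℝ) =>
          (‖F (y, r.2) - F (y, r.1)‖ₑ ^ 2 * (q (y, r.1) * q (y, r.2)))) ?_
      fun_prop
    refine lintegral_congr fun z => ?_
    rw [← lintegral_const_mul _ (by fun_prop)]
    simp only
    rw [← lintegral_add_left_eq_self _ z]
  -- the pointwise bound by Cauchy–Schwarz
  have h2 : ∀ v, ∫⁻ p : Y × (Fin d → ℝ), (m p.1)⁻¹ * (‖F (p.1, p.2 + v) - F p‖ₑ ^ 2 * (q p * q (p.1, p.2 + v))) ≤ ∫⁻ p : Y × (Fin d → ℝ), ∫⁻ τ in Ioo (0 : ℝ) 1, M * ((a τ)⁻¹ * ((m p.1)⁻¹ *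
          (N v * (S (p.1, p.2 + τ • v) * (q p * q (p.1, p.2 + v)))))) := by
    intro v
    refine lintegral_mono_ae ?_
    filter_upwards [hF v] with p hp
    by_cases hq0 : q p = 0
    · simp [hq0]
    by_cases hq1 : q (p.1, p.2 + v) = 0
    · simp [hq1]
    have h3 := hp hq0 hq1
    rw [setLIntegral_congr Ioo_ae_eq_Ioc.symm] at h3
    -- Without the weight the final constant would be `∫ a²`, which diverges for the Gaussian;
    -- dividing by `a` inside turns it into `(∫ a)²`.
    have h4 : ‖F (p.1, p.2 + v) - F p‖ₑ ^ 2 ≤ M * ∫⁻ τ in Ioo (0 : ℝ) 1,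
        (a τ)⁻¹ * ‖∑ j, v j * H j (p.1, p.2 + τ • v)‖ₑ ^ 2 :=
      (pow_le_pow_left₀ zero_le h3 2).trans (sq_lintegral_le_weighted ham (by fun_prop)
        ((ae_restrict_iff' measurableSet_Ioo).2 (Eventually.of_forall ha)))
    calc _ ≤ (m p.1)⁻¹ * ((M * ∫⁻ τ in Ioo (0 : ℝ) 1, (a τ)⁻¹ * (N v * S (p.1, p.2 + τ • v))) *
            (q p * q (p.1, p.2 + v))) := by
          gcongr
          refine h4.trans ?_
          gcongr
          exact enorm_sum_mul_sq_le _ _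
      _ = ∫⁻ τ in Ioo (0 : ℝ) 1, ((m p.1)⁻¹ * M * (q p * q (p.1, p.2 + v))) *
            ((a τ)⁻¹ * (N v * S (p.1, p.2 + τ • v))) := by
          rw [lintegral_const_mul _ (by fun_prop)]
          ring
      _ = _ := by
          refine lintegral_congr fun τ => ?_
          ring
  have hmeas : Measurable fun r : ((Fin d → ℝ) × (Y × (Fin d → ℝ))) × ℝ =>
      M * ((a r.2)⁻¹ * ((m r.1.2.1)⁻¹ * (N r.1.1 * (S (r.1.2.1, r.1.2.2 + r.2 • r.1.1) *
        (q r.1.2 * q (r.1.2.1, r.1.2.2 + r.1.1)))))) := by fun_prop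
  -- the bound for a fixed parameter of the segment
  have h5 : ∀ τ ∈ Ioo (0 : ℝ) 1, ∫⁻ r : (Fin d → ℝ) × (Y × (Fin d → ℝ)),
      M * ((a τ)⁻¹ * ((m r.2.1)⁻¹ * (N r.1 * (S (r.2.1, r.2.2 + τ • r.1) *
        (q r.2 * q (r.2.1, r.2.2 + r.1)))))) ≤
      a τ * (M * ∫⁻ y, ∫⁻ z, S (y, z) * q (y, z)) := by
    intro τ hτ
    calc _ = M * ((a τ)⁻¹ * ∫⁻ r : (Fin d → ℝ) × (Y × (Fin d → ℝ)),
          ((m r.2.1)⁻¹ * (N r.1 * (S (r.2.1, r.2.2 + τ • r.1) *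
            (q r.2 * q (r.2.1, r.2.2 + r.1)))))) := by
          rw [lintegral_const_mul _ (by fun_prop), lintegral_const_mul _ (by fun_prop)]
      _ = M * ((a τ)⁻¹ * ∫⁻ v, ∫⁻ y, ∫⁻ z, ((m y)⁻¹ * (N v * (S (y, z + τ • v) *
            (q (y, z) * q (y, z + v)))))) := by
          rw [Measure.volume_eq_prod, lintegral_prod _ (by fun_prop)]
          congr 2
          refine lintegral_congr fun v => ?_
          rw [Measure.volume_eq_prod, lintegral_prod _ (by fun_prop)]
      -- The substitution `u = z + τ v` frees the gradient term of `v`, so that the `v`-integral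
      -- becomes the kernel of `hq`.
      _ = M * ((a τ)⁻¹ * ∫⁻ v, ∫⁻ y, ∫⁻ u, ((m y)⁻¹ * (N v * (S (y, u) *
            (q (y, u - τ • v) * q (y, u + (1 - τ) • v)))))) := by
          congr 2
          refine lintegral_congr fun v => lintegral_congr fun y => ?_
          rw [← lintegral_add_right_eq_self (fun u => (m y)⁻¹ * (N v * (S (y, u) *
            (q (y, u - τ • v) * q (y, u + (1 - τ) • v))))) (τ • v)]
          refine lintegral_congr fun z => ?_
          rw [add_sub_cancel_right, add_assoc z, ← add_smul, add_sub_cancel, one_smul]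
      _ = M * ((a τ)⁻¹ * ∫⁻ y, ∫⁻ u, ∫⁻ v, ((m y)⁻¹ * (N v * (S (y, u) *
            (q (y, u - τ • v) * q (y, u + (1 - τ) • v)))))) := by
          congr 2
          rw [lintegral_lintegral_swap]
          · refine lintegral_congr fun y => ?_
            rw [lintegral_lintegral_swap (by fun_prop)]
          · refine Measurable.aemeasurable ?_
            exact Measurable.lintegral_prod_right'
              (f := fun r : ((Fin d → ℝ) × Y) × (Fin d → ℝ) => (m r.1.2)⁻¹ * (N r.1.1 *
                (S (r.1.2, r.2) * (q (r.1.2, r.2 - τ • r.1.1) *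
                  q (r.1.2, r.2 + (1 - τ) • r.1.1))))) (by fun_prop)
      _ ≤ M * ((a τ)⁻¹ * ∫⁻ y, ∫⁻ u, a τ ^ 2 * (S (y, u) * q (y, u))) := by
          gcongr with y u
          calc _ = (m y)⁻¹ * (S (y, u) * ∫⁻ v, N v *
                  (q (y, u - τ • v) * q (y, u + (1 - τ) • v))) := by
                rw [← lintegral_const_mul _ (by fun_prop), ← lintegral_const_mul _ (by fun_prop)]
                refine lintegral_congr fun v => ?_
                ring
            _ ≤ (m y)⁻¹ * (S (y, u) * (a τ ^ 2 * (q (y, u) * m y))) := by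
                gcongr
                exact hq τ hτ y u
            _ = ((m y)⁻¹ * m y) * (a τ ^ 2 * (S (y, u) * q (y, u))) := by ring
            -- An inequality, since `m y` may be `0` or `⊤`.
            _ ≤ 1 * (a τ ^ 2 * (S (y, u) * q (y, u))) := by
                gcongr
                exact ENNReal.inv_mul_le_one _
            _ = _ := one_mul _
      _ = ((a τ)⁻¹ * a τ) * (a τ * (M * ∫⁻ y, ∫⁻ z, S (y, z) * q (y, z))) := by
          have hSq : Measurable fun y => ∫⁻ u, S (y, u) * q (y, u) :=
            Measurable.lintegral_prod_right' (f := fun r => S r * q r) (by fun_prop)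
          have : ∀ y, ∫⁻ u, a τ ^ 2 * (S (y, u) * q (y, u)) =
              a τ ^ 2 * ∫⁻ u, (S (y, u) * q (y, u)) := fun y =>
            lintegral_const_mul _ (by fun_prop)
          simp_rw [this]
          rw [lintegral_const_mul _ hSq]
          ring
      _ = _ := by rw [ENNReal.inv_mul_cancel (ha τ hτ).1 (ha τ hτ).2, one_mul]
  rw [h1]
  calc _ ≤ ∫⁻ v, ∫⁻ p : Y × (Fin d → ℝ), ∫⁻ τ in Ioo (0 : ℝ) 1, M * ((a τ)⁻¹ * ((m p.1)⁻¹ *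
          (N v * (S (p.1, p.2 + τ • v) * (q p * q (p.1, p.2 + v)))))) :=
        lintegral_mono h2
    _ = ∫⁻ r : (Fin d → ℝ) × (Y × (Fin d → ℝ)), ∫⁻ τ in Ioo (0 : ℝ) 1, M * ((a τ)⁻¹ * ((m r.2.1)⁻¹ *
          (N r.1 * (S (r.2.1, r.2.2 + τ • r.1) * (q r.2 * q (r.2.1, r.2.2 + r.1)))))) := by
        exact (lintegral_prod _ hmeas.lintegral_prod_right'.aemeasurable).symm
    _ = ∫⁻ τ in Ioo (0 : ℝ) 1, ∫⁻ r : (Fin d → ℝ) × (Y × (Fin d → ℝ)),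
          M * ((a τ)⁻¹ * ((m r.2.1)⁻¹ * (N r.1 * (S (r.2.1, r.2.2 + τ • r.1) *
            (q r.2 * q (r.2.1, r.2.2 + r.1)))))) := by
        rw [lintegral_lintegral_swap hmeas.aemeasurable]
    _ ≤ ∫⁻ τ in Ioo (0 : ℝ) 1, a τ * (M * ∫⁻ y, ∫⁻ z, S (y, z) * q (y, z)) :=
        setLIntegral_mono (by fun_prop) h5
    _ = _ := by
        rw [lintegral_mul_const _ ham]
        ring

/-- A function with finite mean square increment is integrable, and its variance is bounded by the
mean square increment. -/
theorem integrable_and_lintegral_sub_average_sq_le {Z : Type*} [MeasurableSpace Z]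
    {ν : Measure Z} [IsFiniteMeasure ν] (hν : ν ≠ 0) {F : Z → ℝ} (hFm : Measurable F)
    (hJ : ∫⁻ z, ∫⁻ z', ‖F z' - F z‖ₑ ^ 2 ∂ν ∂ν ≠ ⊤) :
    Integrable F ν ∧ ∫⁻ z, ‖F z - ⨍ z', F z' ∂ν‖ₑ ^ 2 ∂ν ≤
      (ν univ)⁻¹ * ∫⁻ z, ∫⁻ z', ‖F z' - F z‖ₑ ^ 2 ∂ν ∂ν := by
  have hm : Measurable fun z => ∫⁻ z', ‖F z' - F z‖ₑ ^ 2 ∂ν :=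
    Measurable.lintegral_prod_right' (f := fun r : Z × Z => ‖F r.2 - F r.1‖ₑ ^ 2) (by fun_prop)
  have : NeZero ν := ⟨hν⟩
  have hν0 : ν univ ≠ 0 := by simpa using hν
  have hνt : ν univ ≠ ⊤ := measure_ne_top _ _
  have hint : Integrable F ν := by
    -- For some `z₀` the function `F - F z₀` is in `L²`, hence in `L¹` as the measure is finite.
    obtain ⟨z₀, hz₀⟩ := (ae_lt_top hm hJ).exists
    have h2 : MemLp (fun z => F z - F z₀) 2 ν := by
      refine ⟨by fun_prop, ?_⟩
      rw [eLpNorm_lt_top_iff_lintegral_rpow_enorm_lt_top (by simp) (by simp)]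
      simpa using hz₀
    have h3 := (h2.integrable (by norm_num)).add (integrable_const (F z₀))
    simpa [Pi.add_def] using h3
  refine ⟨hint, ?_⟩
  rw [← lintegral_const_mul _ hm]
  refine lintegral_mono fun z => ?_
  -- The deviation from the mean is an average of increments, to which Cauchy–Schwarz applies. This
  -- loses the factor `1/2` of the exact variance formula.
  have e1 : F z - ⨍ z', F z' ∂ν = -((ν.real univ)⁻¹ * ∫ z', (F z' - F z) ∂ν) := by
    rw [integral_sub hint (integrable_const _), average_eq, integral_const]
    have : ν.real univ ≠ 0 := by simp [measureReal_def, ENNReal.toReal_eq_zero_iff, hν]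
    simp only [smul_eq_mul]
    field_simp
    ring
  have e2 : ‖(ν.real univ)⁻¹‖ₑ = (ν univ)⁻¹ := by
    rw [enorm_inv (by simp [measureReal_def, ENNReal.toReal_eq_zero_iff, hν]), measureReal_def,
      Real.enorm_of_nonneg ENNReal.toReal_nonneg, ENNReal.ofReal_toReal hνt]
  rw [e1, enorm_neg, enorm_mul, e2]
  have h4 := sq_lintegral_le_weighted (μ := ν) (a := fun _ => 1) (f := fun z' => ‖F z' - F z‖ₑ)
    measurable_const (by fun_prop) (by simp)
  simp only [lintegral_const, one_mul, inv_one] at h4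
  calc _ ≤ ((ν univ)⁻¹ * ∫⁻ z', ‖F z' - F z‖ₑ ∂ν) ^ 2 := by
        gcongr
        exact enorm_integral_le_lintegral_enorm _
    _ = (ν univ)⁻¹ ^ 2 * (∫⁻ z', ‖F z' - F z‖ₑ ∂ν) ^ 2 := mul_pow _ _ _
    _ ≤ (ν univ)⁻¹ ^ 2 * (ν univ * ∫⁻ z', ‖F z' - F z‖ₑ ^ 2 ∂ν) := by gcongr
    _ = ((ν univ)⁻¹ * ν univ) * ((ν univ)⁻¹ * ∫⁻ z', ‖F z' - F z‖ₑ ^ 2 ∂ν) := by ring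
    _ = _ := by rw [ENNReal.inv_mul_cancel hν0 hνt, one_mul]

/-! ### Kernel bounds for uniform and Gaussian densities. -/

theorem lintegral_comp_smul {d : ℕ} {f : (Fin d → ℝ) → ENNReal} (hf : Measurable f) {r : ℝ}
    (hr : r ≠ 0) : ∫⁻ x, f (r • x) = ENNReal.ofReal |(r ^ d)⁻¹| * ∫⁻ x, f x := by
  have h := Measure.map_addHaar_smul (volume : Measure (Fin d → ℝ)) hr
  rw [← lintegral_map hf (measurable_const_smul r), h, lintegral_smul_measure]
  simp

/-- The Jacobian `|r|⁻ᵈ` is at most `2ᵈ`; using `2ⁿ` makes the bound uniform in the dimension of the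
slice. -/
theorem lintegral_comp_add_smul_le {d n : ℕ} (hdn : d ≤ n) {f : (Fin d → ℝ) → ENNReal}
    (hf : Measurable f) {r : ℝ} (hr : 1 / 2 ≤ |r|) (u : Fin d → ℝ) :
    ∫⁻ x, f (u + r • x) ≤ ENNReal.ofReal (2 ^ n) * ∫⁻ x, f x := by
  have hr0 : r ≠ 0 := by rintro rfl; norm_num at hr
  rw [lintegral_comp_smul (f := fun x => f (u + x)) (by fun_prop) hr0,
    lintegral_add_left_eq_self f u]
  gcongr
  rw [abs_inv, abs_pow]
  calc (|r| ^ d)⁻¹ = (|r|⁻¹) ^ d := (inv_pow _ _).symm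
    _ ≤ 2 ^ d := by
        gcongr
        rw [inv_le_comm₀ (abs_pos.2 hr0) two_pos]
        simpa using hr
    _ ≤ 2 ^ n := pow_le_pow_right₀ one_le_two hdn

/-- The kernel bound for the indicator of a convex set. -/
theorem lintegral_kernel_indicator_le {d n : ℕ} (hdn : d ≤ n) {V : Set (Fin d → ℝ)}
    (hV : Convex ℝ V) (hVm : MeasurableSet V) {D : ℝ}
    (hD : ∀ z ∈ V, ∀ z' ∈ V, ∑ j, (z j - z' j) ^ 2 ≤ D) (A : ENNReal) {q : (Fin d → ℝ) → ENNReal}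
    (hq : q = V.indicator fun _ => A) {τ : ℝ} (hτ : τ ∈ Ioo (0 : ℝ) 1) (u : Fin d → ℝ) :
    ∫⁻ v : Fin d → ℝ, ENNReal.ofReal (∑ j, v j ^ 2) * (q (u - τ • v) * q (u + (1 - τ) • v)) ≤
      ENNReal.ofReal D * ENNReal.ofReal (2 ^ n) * (q u * ∫⁻ z, q z) := by
  have hqm : Measurable q := by rw [hq]; exact measurable_const.indicator hVm
  -- If both endpoints lie in `V`, so does `u`, and all three values of `q` are `A`. Either endpoint
  -- factor can thus be traded for `q u`; the one kept is that with the coefficient of `v` at least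
  -- `1/2`.
  have hpt : ∀ v, ENNReal.ofReal (∑ j, v j ^ 2) * (q (u - τ • v) * q (u + (1 - τ) • v)) ≤
      ENNReal.ofReal D * q u * q (u - τ • v) ∧
      ENNReal.ofReal (∑ j, v j ^ 2) * (q (u - τ • v) * q (u + (1 - τ) • v)) ≤
      ENNReal.ofReal D * q u * q (u + (1 - τ) • v) := by
    intro v
    by_cases h1 : u - τ • v ∈ V
    swap
    · simp [hq, h1]
    by_cases h2 : u + (1 - τ) • v ∈ V
    swap
    · simp [hq, h2]
    have hu : u ∈ V := by
      have := hV h1 h2 (a := 1 - τ) (b := τ) (by linarith [hτ.2]) hτ.1.le (by ring)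
      convert this using 1
      module
    have hv : ∑ j, v j ^ 2 ≤ D := by
      refine le_trans (le_of_eq ?_) (hD _ h2 _ h1)
      refine Finset.sum_congr rfl fun j _ => ?_
      simp only [Pi.add_apply, Pi.sub_apply, Pi.smul_apply, smul_eq_mul]
      ring
    simp only [hq, indicator_of_mem, h1, h2, hu, mul_assoc]
    exact ⟨by gcongr, by gcongr⟩
  rcases le_total (1 / 2) τ with h | h
  · calc _ ≤ ∫⁻ v, ENNReal.ofReal D * q u * q (u + (-τ) • v) := by
          refine lintegral_mono fun v => ?_
          rw [neg_smul, ← sub_eq_add_neg]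
          exact (hpt v).1
      _ ≤ ENNReal.ofReal D * q u * (ENNReal.ofReal (2 ^ n) * ∫⁻ z, q z) := by
          rw [lintegral_const_mul _ (by fun_prop)]
          gcongr
          exact lintegral_comp_add_smul_le hdn hqm (by rwa [abs_neg, abs_of_pos hτ.1]) u
      _ = _ := by ring
  · calc _ ≤ ∫⁻ v, ENNReal.ofReal D * q u * q (u + (1 - τ) • v) :=
          lintegral_mono fun v => (hpt v).2
      _ ≤ ENNReal.ofReal D * q u * (ENNReal.ofReal (2 ^ n) * ∫⁻ z, q z) := by
          rw [lintegral_const_mul _ (by fun_prop)]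
          gcongr
          exact lintegral_comp_add_smul_le hdn hqm
            (by rw [abs_of_pos (by linarith [hτ.2])]; linarith) u
      _ = _ := by ring

/-- With `σ = τ(1-τ)`, `s = 1 - 3σ ≥ 1/4` and `θ = (1-2τ)/s`, completing the square shows that the
right side minus `u² + σv²` equals `s(v + θu)² + (1 - θ²s)u²`, and `θ²s ≤ 1`. The three terms on the
left serve to produce `q u`, to absorb the factor `|v|²`, and to leave a Gaussian in `v` of fixed
scale. -/
theorem gaussian_exponent_le (τ : ℝ) (hτ : τ ∈ Ioo (0 : ℝ) 1) (u v : ℝ) :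
    u ^ 2 + τ * (1 - τ) * v ^ 2 +
      ((1 / 2 : ℝ) * ((1 - 2 * τ) / (1 - 3 * (τ * (1 - τ))) * u) + (1 / 2 : ℝ) * v) ^ 2 ≤
      (u - τ * v) ^ 2 + (u + (1 - τ) * v) ^ 2 := by
  set σ := τ * (1 - τ) with hσ
  have h0 : 0 < σ := mul_pos hτ.1 (by linarith [hτ.2])
  have h1 : 1 / 4 ≤ 1 - 3 * σ := by nlinarith [sq_nonneg (1 - 2 * τ)]
  set s := 1 - 3 * σ with hs
  have hb : (1 - 2 * τ) ^ 2 = s - σ := by rw [hs, hσ]; ring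
  set θ := (1 - 2 * τ) / s with hθ
  have hθs : θ * s = 1 - 2 * τ := div_mul_cancel₀ _ (by linarith)
  have e : (u - τ * v) ^ 2 + (u + (1 - τ) * v) ^ 2 - (u ^ 2 + σ * v ^ 2) =
      s * (v + θ * u) ^ 2 + (1 - θ * (θ * s)) * u ^ 2 := by
    have : s * (v + θ * u) ^ 2 = s * v ^ 2 + 2 * (θ * s) * u * v + θ * (θ * s) * u ^ 2 := by ring
    rw [this, hθs, hs, hσ]
    ring
  have h2 : θ * (θ * s) ≤ 1 := by
    have : θ * (θ * s) * s ≤ 1 * s := by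
      calc θ * (θ * s) * s = (θ * s) ^ 2 := by ring
        _ = s - σ := by rw [hθs, hb]
        _ ≤ 1 * s := by linarith
    exact le_of_mul_le_mul_right this (by linarith)
  have h3 : ((1 / 2 : ℝ) * (θ * u) + (1 / 2 : ℝ) * v) ^ 2 = 1 / 4 * (v + θ * u) ^ 2 := by ring
  rw [h3]
  nlinarith [mul_nonneg (sub_nonneg.2 h1) (sq_nonneg (v + θ * u)),
    mul_nonneg (sub_nonneg.2 h2) (sq_nonneg u)]

/-- The kernel bound for a Gaussian weight. -/
theorem lintegral_kernel_gaussian_le {d n : ℕ} (hdn : d ≤ n) (A : ENNReal)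
    {q : (Fin d → ℝ) → ENNReal}
    (hq : q = fun z => A * ENNReal.ofReal (Real.exp (-(∑ j, z j ^ 2) / 2)))
    {τ : ℝ} (hτ : τ ∈ Ioo (0 : ℝ) 1) (u : Fin d → ℝ) :
    ∫⁻ v : Fin d → ℝ, ENNReal.ofReal (∑ j, v j ^ 2) * (q (u - τ • v) * q (u + (1 - τ) • v)) ≤
      ENNReal.ofReal (2 / (τ * (1 - τ))) * ENNReal.ofReal (2 ^ n) * (q u * ∫⁻ z, q z) := by
  have hqm : Measurable q := by rw [hq]; fun_prop
  set σ := τ * (1 - τ) with hσ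
  have h0 : 0 < σ := mul_pos hτ.1 (by linarith [hτ.2])
  set θ := (1 - 2 * τ) / (1 - 3 * σ) with hθ
  have hpt : ∀ v, ENNReal.ofReal (∑ j, v j ^ 2) * (q (u - τ • v) * q (u + (1 - τ) • v)) ≤
      ENNReal.ofReal (2 / σ) * q u * q (((1 / 2 : ℝ) • θ • u) + (1 / 2 : ℝ) • v) := by
    intro v
    have hreal : (∑ j, v j ^ 2) * (Real.exp (-(∑ j, (u - τ • v) j ^ 2) / 2) *
        Real.exp (-(∑ j, (u + (1 - τ) • v) j ^ 2) / 2)) ≤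
        2 / σ * (Real.exp (-(∑ j, u j ^ 2) / 2) *
          Real.exp (-(∑ j, (((1 / 2 : ℝ) • θ • u) + (1 / 2 : ℝ) • v) j ^ 2) / 2)) := by
      have hsum := Finset.sum_le_sum fun j (_ : j ∈ Finset.univ) =>
        gaussian_exponent_le τ hτ (u j) (v j)
      simp only [Finset.sum_add_distrib, ← Finset.mul_sum, ← hσ, ← hθ] at hsum
      simp only [Pi.add_apply, Pi.sub_apply, Pi.smul_apply, smul_eq_mul]
      set N := ∑ j, v j ^ 2
      have hN : 0 ≤ N := Finset.sum_nonneg fun _ _ => sq_nonneg _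
      -- From `t ≤ eᵗ` at `t = σN/2`: the reserved `σ|v|²` in the exponent pays for the polynomial
      -- factor.
      have h1 : N ≤ 2 / σ * Real.exp (σ * N / 2) := by
        have := Real.add_one_le_exp (σ * N / 2)
        rw [div_mul_eq_mul_div, le_div_iff₀ h0]
        linarith
      calc _ ≤ 2 / σ * Real.exp (σ * N / 2) *
            (Real.exp (-(∑ j, (u j - τ * v j) ^ 2) / 2) *
              Real.exp (-(∑ j, (u j + (1 - τ) * v j) ^ 2) / 2)) := by gcongr
        _ ≤ _ := by
            rw [mul_assoc, ← Real.exp_add, ← Real.exp_add, ← Real.exp_add]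
            exact mul_le_mul_of_nonneg_left (Real.exp_le_exp.2 (by linarith)) (by positivity)
    simp only [hq]
    calc _ = A * A * ENNReal.ofReal ((∑ j, v j ^ 2) *
          (Real.exp (-(∑ j, (u - τ • v) j ^ 2) / 2) *
            Real.exp (-(∑ j, (u + (1 - τ) • v) j ^ 2) / 2))) := by
          rw [ENNReal.ofReal_mul (Finset.sum_nonneg fun _ _ => sq_nonneg _),
            ENNReal.ofReal_mul (Real.exp_pos _).le]
          ring
      _ ≤ A * A * ENNReal.ofReal (2 / σ * (Real.exp (-(∑ j, u j ^ 2) / 2) *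
          Real.exp (-(∑ j, (((1 / 2 : ℝ) • θ • u) + (1 / 2 : ℝ) • v) j ^ 2) / 2))) := by gcongr
      _ = _ := by
          rw [ENNReal.ofReal_mul (by positivity), ENNReal.ofReal_mul (Real.exp_pos _).le]
          ring
  calc _ ≤ _ := lintegral_mono hpt
    _ ≤ ENNReal.ofReal (2 / σ) * q u * (ENNReal.ofReal (2 ^ n) * ∫⁻ z, q z) := by
        rw [lintegral_const_mul _ (by fun_prop)]
        gcongr
        exact lintegral_comp_add_smul_le hdn hqm (by norm_num) _
    _ = _ := by ring

theorem stdNormalDensity_eq (n : ℕ) (x : Fin n → ℝ) :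
    stdNormalDensity n x = (√(2 * Real.pi))⁻¹ ^ n * Real.exp (-(∑ i, x i ^ 2) / 2) := by
  simp only [stdNormalDensity, ProbabilityTheory.gaussianPDFReal]
  rw [Finset.prod_mul_distrib, ← Real.exp_sum, ← Finset.sum_div]
  simp

/-- The properties of a density on which the Poincaré inequality for its slices is based. -/
structure IsPoincareDensity {n : ℕ} (ρ : (Fin n → ℝ) → ℝ) : Prop where
  isOpen : IsOpen (domain ρ)
  convex : Convex ℝ (domain ρ)
  measurable : Measurable ρ
  nonneg : ∀ x, 0 ≤ ρ x
  lower_bound : ∀ R : ℕ, ∃ c > 0, ∀ x ∈ domain ρ ∩ Metric.ball 0 R, c ≤ ρ x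
  kernel_bound : ∃ a : ℝ → ENNReal, Measurable a ∧ (∀ τ ∈ Ioo (0 : ℝ) 1, a τ ≠ 0 ∧ a τ ≠ ⊤) ∧
    ∫⁻ τ in Ioo (0 : ℝ) 1, a τ ≠ ⊤ ∧
    ∀ (k : ℕ) (hk : k < n), ∀ Q ∈ Matrix.orthogonalGroup (Fin n) ℝ, ∀ τ ∈ Ioo (0 : ℝ) 1, ∀ y u,
      ∫⁻ v, ENNReal.ofReal (∑ j, v j ^ 2) * (ENNReal.ofReal (ρ (point hk Q y (u - τ • v))) *
        ENNReal.ofReal (ρ (point hk Q y (u + (1 - τ) • v)))) ≤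
      a τ ^ 2 * (ENNReal.ofReal (ρ (point hk Q y u)) * ∫⁻ z, ENNReal.ofReal (ρ (point hk Q y z)))

theorem isPoincareDensity_stdNormalDensity (n : ℕ) : IsPoincareDensity (stdNormalDensity n) := by
  have hpos : ∀ x, 0 < stdNormalDensity n x := fun x => by
    rw [stdNormalDensity_eq]; positivity
  have hdom : domain (stdNormalDensity n) = univ := eq_univ_of_forall hpos
  have hcont : Continuous (stdNormalDensity n) := by
    rw [funext (stdNormalDensity_eq n)]
    fun_prop
  refine ⟨hdom ▸ isOpen_univ, hdom ▸ convex_univ, hcont.measurable, fun x => (hpos x).le, ?_, ?_⟩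
  · intro R
    obtain ⟨x, -, hx⟩ := (isCompact_closedBall (0 : Fin n → ℝ) R).exists_isMinOn
      ⟨0, by simp⟩ hcont.continuousOn
    exact ⟨_, hpos x, fun y hy => hx (Metric.ball_subset_closedBall hy.2)⟩
  -- The square of the bracket dominates `1/τ + 1/(1-τ) = 1/(τ(1-τ))`, while the bracket itself is
  -- integrable on the unit interval.
  · refine ⟨fun τ => ENNReal.ofReal (2 ^ (n + 1) *
      (τ ^ (-(1 / 2) : ℝ) + (1 - τ) ^ (-(1 / 2) : ℝ))), by fun_prop, ?_, ?_, ?_⟩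
    · intro τ hτ
      have h1 := hτ.1
      have h2 : 0 < 1 - τ := by linarith [hτ.2]
      refine ⟨?_, ENNReal.ofReal_ne_top⟩
      have : 0 < 2 ^ (n + 1) * (τ ^ (-(1 / 2) : ℝ) + (1 - τ) ^ (-(1 / 2) : ℝ)) := by positivity
      simpa using this
    · have h1 : IntervalIntegrable (fun τ : ℝ => τ ^ (-(1 / 2) : ℝ)) volume 0 1 :=
        intervalIntegral.intervalIntegrable_rpow' (by norm_num)
      have h2 : IntervalIntegrable (fun τ : ℝ => (1 - τ) ^ (-(1 / 2) : ℝ)) volume 0 1 := by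
        have := h1.comp_sub_left 1
        simpa using this.symm
      have h3 := (h1.add h2).const_mul (2 ^ (n + 1))
      rw [intervalIntegrable_iff, uIoc_of_le zero_le_one] at h3
      have h4 : IntegrableOn _ (Ioo (0 : ℝ) 1) := h3.mono_set Ioo_subset_Ioc_self
      exact h4.lintegral_lt_top.ne
    · intro k hk Q hQ τ hτ y u
      have h1 := hτ.1
      have h2 : 0 < 1 - τ := by linarith [hτ.2]
      refine (lintegral_kernel_gaussian_le (n := n) (Nat.sub_le n k)
        (ENNReal.ofReal ((√(2 * Real.pi))⁻¹ ^ n * Real.exp (-(∑ i, y i ^ 2) / 2)))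
        (q := fun z => ENNReal.ofReal (stdNormalDensity n (point hk Q y z))) ?_ hτ u).trans ?_
      · ext z
        rw [← ENNReal.ofReal_mul (by positivity), stdNormalDensity_eq, sum_sq_point hk hQ,
          mul_assoc, ← Real.exp_add]
        congr 3
        ring
      · gcongr
        rw [← ENNReal.ofReal_mul (by positivity), ← ENNReal.ofReal_pow (by positivity)]
        refine ENNReal.ofReal_le_ofReal ?_
        have e1 : (τ ^ (-(1 / 2) : ℝ)) ^ 2 = τ⁻¹ := by
          rw [← Real.rpow_natCast, ← Real.rpow_mul h1.le, ← Real.rpow_neg_one]; norm_num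
        have e2 : ((1 - τ) ^ (-(1 / 2) : ℝ)) ^ 2 = (1 - τ)⁻¹ := by
          rw [← Real.rpow_natCast, ← Real.rpow_mul h2.le, ← Real.rpow_neg_one]; norm_num
        have e3 : 2 / (τ * (1 - τ)) * 2 ^ n = 2 ^ (n + 1) * (τ⁻¹ + (1 - τ)⁻¹) := by
          field_simp
          ring
        have h3 : (1 : ℝ) ≤ 2 ^ (n + 1) := one_le_pow₀ one_le_two
        have h4 : τ⁻¹ + (1 - τ)⁻¹ ≤ (τ ^ (-(1 / 2) : ℝ) + (1 - τ) ^ (-(1 / 2) : ℝ)) ^ 2 := by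
          rw [add_sq, e1, e2]
          have : 0 ≤ 2 * τ ^ (-(1 / 2) : ℝ) * (1 - τ) ^ (-(1 / 2) : ℝ) := by positivity
          linarith
        rw [e3, mul_pow]
        gcongr
        exact le_self_pow₀ h3 two_ne_zero

theorem IsUniformOnConvex.isPoincareDensity {n : ℕ} {ρ : (Fin n → ℝ) → ℝ}
    (h : IsUniformOnConvex ρ) : IsPoincareDensity ρ := by
  obtain ⟨U, hUo, hUn, hUb, hUc, rfl⟩ := h
  have hvol : 0 < (volume.real U)⁻¹ := by
    rw [inv_pos, measureReal_def, ENNReal.toReal_pos_iff]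
    exact ⟨hUo.measure_pos volume hUn, hUb.measure_lt_top⟩
  have hdom : domain (uniformDensity U) = U := by
    ext x
    by_cases hx : x ∈ U
    · simp [domain, uniformDensity, hx, hvol]
    · simp [domain, uniformDensity, hx]
  refine ⟨by rwa [hdom], by rwa [hdom], measurable_const.indicator hUo.measurableSet,
    fun x => indicator_nonneg (fun _ _ => hvol.le) x, ?_, ?_⟩
  · intro R
    refine ⟨_, hvol, fun x hx => ?_⟩
    rw [hdom] at hx
    simp [uniformDensity, hx.1]
  · obtain ⟨R, hR⟩ := hUb.exists_norm_le
    -- A bound for the squared Euclidean diameter of `U`; it serves every slice, because `z ↦ point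
    -- hk Q y z` is an isometry.
    set D : ℝ := ∑ _i : Fin n, (2 * R) ^ 2 with hD
    have hD0 : 0 ≤ D := Finset.sum_nonneg fun _ _ => sq_nonneg _
    have hUD : ∀ x ∈ U, ∀ x' ∈ U, ∑ i, (x i - x' i) ^ 2 ≤ D := by
      intro x hx x' hx'
      refine Finset.sum_le_sum fun i _ => ?_
      have h1 := (norm_le_pi_norm x i).trans (hR x hx)
      have h2 := (norm_le_pi_norm x' i).trans (hR x' hx')
      rw [Real.norm_eq_abs, abs_le] at h1 h2
      exact sq_le_sq' (by linarith) (by linarith)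
    -- The `+ 1` keeps the weight positive and makes its square at least `D * 2 ^ n`.
    refine ⟨fun _ => ENNReal.ofReal (D * 2 ^ n + 1), measurable_const, ?_, ?_, ?_⟩
    · intro τ _
      have : 0 < D * 2 ^ n + 1 := by positivity
      exact ⟨by simpa using this, ENNReal.ofReal_ne_top⟩
    · simp
    · intro k hk Q hQ τ hτ y u
      have hlin : ∀ z z' i, point hk Q y z i - point hk Q y z' i = point hk Q 0 (z - z') i := by
        intro z z' i
        simp [point, Matrix.mulVec_sub]
      refine (lintegral_kernel_indicator_le (n := n) (Nat.sub_le n k)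
        (V := {z | point hk Q y z ∈ U}) ?_ ?_ (D := D) ?_ (ENNReal.ofReal (volume.real U)⁻¹)
        (q := fun z => ENNReal.ofReal (uniformDensity U (point hk Q y z))) ?_ hτ u).trans ?_
      · intro z hz z' hz' a b ha hb hab
        have hcomb : point hk Q y (a • z + b • z') =
            a • point hk Q y z + b • point hk Q y z' := by
          simp only [point, Matrix.mulVec_add, Matrix.mulVec_smul, smul_add]
          have e : firstCols hk Q *ᵥ y = a • firstCols hk Q *ᵥ y + b • firstCols hk Q *ᵥ y := by
            rw [← add_smul, hab, one_smul]
          conv_lhs => rw [e]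
          abel
        change point hk Q y (a • z + b • z') ∈ U
        rw [hcomb]
        exact hUc hz hz' ha hb hab
      · have : Measurable fun z => point hk Q y z := by unfold point; fun_prop
        exact this hUo.measurableSet
      · intro z hz z' hz'
        have h1 := hUD _ hz _ hz'
        simp only [hlin, sum_sq_point hk hQ] at h1
        simpa using h1
      · ext z
        by_cases hz : point hk Q y z ∈ U
        · simp [uniformDensity, hz]
        · simp [uniformDensity, hz]
      · gcongr
        rw [← ENNReal.ofReal_mul hD0, ← ENNReal.ofReal_pow (by positivity)]
        refine ENNReal.ofReal_le_ofReal ?_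
        have : 0 ≤ D * 2 ^ n := by positivity
        nlinarith

/-! ### Admissible functions and the energy of their gradients. -/

/-- The partial derivative of `f`, extended by zero outside of the domain of `ρ`. -/
noncomputable def partialExt {n : ℕ} (ρ f : (Fin n → ℝ) → ℝ) (i : Fin n) : (Fin n → ℝ) → ℝ :=
  (domain ρ).indicator (partialDeriv f i)

section Admissible

variable {n : ℕ} {ρ f : (Fin n → ℝ) → ℝ}

theorem IsAdmissible.measurable_indicator (hρ : IsPoincareDensity ρ) (hf : IsAdmissible ρ f) :
    Measurable ((domain ρ).indicator f) := by
  refine measurable_of_restrict_of_restrict_compl hρ.isOpen.measurableSet ?_ ?_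
  · convert! hf.measurable using 1
    ext x
    exact indicator_of_mem x.2 f
  · convert! measurable_const (a := (0 : ℝ)) using 1
    ext x
    exact indicator_of_notMem x.2 f

theorem IsAdmissible.hasDerivAt_indicator (hρ : IsPoincareDensity ρ) (hf : IsAdmissible ρ f)
    {x : Fin n → ℝ} (hx : x ∈ domain ρ) (i : Fin n) :
    HasDerivAt (fun t : ℝ => (domain ρ).indicator f (x + t • Pi.single i 1))
      (partialExt ρ f i x) 0 := by
  have h : HasDerivAt (fun t : ℝ => f (x + t • Pi.single i 1)) (partialDeriv f i x) 0 :=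
    (hf.hasPartials x hx i).hasLineDerivAt
  rw [partialExt, indicator_of_mem hx]
  refine h.congr_of_eventuallyEq ?_
  have hc : Continuous fun t : ℝ => x + t • (Pi.single i 1 : Fin n → ℝ) := by fun_prop
  have hev := hc.continuousAt.preimage_mem_nhds (x := 0)
    (hρ.isOpen.mem_nhds (by simpa using hx))
  filter_upwards [hev] with t ht
  exact indicator_of_mem (show x + t • (Pi.single i 1 : Fin n → ℝ) ∈ domain ρ from ht) f

/-- On the domain it is a pointwise limit of difference quotients of the zero extension of `f`. -/
theorem IsAdmissible.measurable_partialExt (hρ : IsPoincareDensity ρ) (hf : IsAdmissible ρ f)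
    (i : Fin n) : Measurable (partialExt ρ f i) := by
  have hFm := hf.measurable_indicator hρ
  refine measurable_of_tendsto_metrizable (f := fun N : ℕ => (domain ρ).indicator fun x =>
    ((1 / ((N : ℝ) + 1))⁻¹) • ((domain ρ).indicator f (x + (1 / ((N : ℝ) + 1)) • Pi.single i 1) -
      (domain ρ).indicator f x)) (fun N => Measurable.indicator (by fun_prop)
        hρ.isOpen.measurableSet) ?_
  rw [tendsto_pi_nhds]
  intro x
  by_cases hx : x ∈ domain ρ
  · have h := (hasDerivAt_iff_tendsto_slope_zero.1 (hf.hasDerivAt_indicator hρ hx i))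
    have h2 : Tendsto (fun N : ℕ => 1 / ((N : ℝ) + 1)) atTop (𝓝[≠] 0) :=
      tendsto_nhdsWithin_iff.2 ⟨tendsto_one_div_add_atTop_nhds_zero_nat,
        Eventually.of_forall fun N => by
          simp only [mem_compl_iff, mem_singleton_iff]; positivity⟩
    have h3 := h.comp h2
    simpa [Function.comp_def, hx] using h3
  · simp [partialExt, hx]

theorem IsAdmissible.integrable_mul (hρ : IsPoincareDensity ρ) (hf : IsAdmissible ρ f)
    (i j : Fin n) : Integrable fun x => partialExt ρ f i x * partialExt ρ f j x * ρ x := by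
  have hsq : ∀ i, Integrable fun x => partialExt ρ f i x ^ 2 * ρ x := by
    intro i
    have := (hf.sqIntegrable i).integrable_indicator hρ.isOpen.measurableSet
    refine this.congr (Eventually.of_forall fun x => ?_)
    by_cases hx : x ∈ domain ρ <;> simp [partialExt, hx]
  have hi := hf.measurable_partialExt hρ i
  have hj := hf.measurable_partialExt hρ j
  have hm := hρ.measurable
  refine ((hsq i).add (hsq j)).mono' (by fun_prop) (Eventually.of_forall fun x => ?_)
  have h0 := hρ.nonneg x
  rw [norm_mul, Real.norm_of_nonneg h0, Pi.add_apply, ← add_mul, Real.norm_eq_abs]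
  gcongr
  rw [abs_le]
  constructor <;> nlinarith [sq_nonneg (partialExt ρ f i x - partialExt ρ f j x),
    sq_nonneg (partialExt ρ f i x + partialExt ρ f j x)]

/-- On a ball `ρ` is bounded below, so weighted square integrability becomes unweighted, and `|p| ≤
1 + p²`. -/
theorem IsAdmissible.integrableOn_partialExt (hρ : IsPoincareDensity ρ) (hf : IsAdmissible ρ f)
    (i : Fin n) (R : ℕ) : IntegrableOn (partialExt ρ f i) (domain ρ ∩ Metric.ball 0 R) := by
  obtain ⟨c, hc, hcle⟩ := hρ.lower_bound R
  have hS : MeasurableSet (domain ρ ∩ Metric.ball (0 : Fin n → ℝ) R) :=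
    hρ.isOpen.measurableSet.inter Metric.isOpen_ball.measurableSet
  have h1 : IntegrableOn (fun _ => (1 : ℝ)) (domain ρ ∩ Metric.ball (0 : Fin n → ℝ) R) :=
    integrableOn_const (measure_ne_top_of_subset inter_subset_right measure_ball_lt_top.ne)
  have h2 := ((hf.integrable_mul hρ i i).const_mul c⁻¹).integrableOn
    (s := domain ρ ∩ Metric.ball (0 : Fin n → ℝ) R)
  refine Integrable.mono' (h1.add h2) (hf.measurable_partialExt hρ i).aestronglyMeasurable ?_
  refine (ae_restrict_iff' hS).2 (Eventually.of_forall fun x hx => ?_)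
  have hle := hcle x hx
  have h3 : 1 ≤ c⁻¹ * ρ x := by
    rw [inv_mul_eq_div, le_div_iff₀ hc]; linarith
  set p := partialExt ρ f i x
  have h4 : p * p ≤ c⁻¹ * (p * p * ρ x) := by
    nlinarith [mul_nonneg (mul_self_nonneg p) (sub_nonneg.2 h3)]
  rw [Real.norm_eq_abs, Pi.add_apply, abs_le]
  constructor <;> nlinarith [sq_nonneg (p - 1), sq_nonneg (p + 1)]

/-- The quadratic form of the gradient matrix. -/
theorem IsAdmissible.integral_sum_mul_sq (hρ : IsPoincareDensity ρ) (hf : IsAdmissible ρ f)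
    {W : Matrix (Fin n) (Fin n) ℝ} {l : Fin n → ℝ}
    (hW : IsEigendecomposition (gradMatrix ρ f) W l) (c : Fin n → ℝ) :
    Integrable (fun x => (∑ a, c a * partialExt ρ f a x) ^ 2 * ρ x) ∧
      ∫ x, (∑ a, c a * partialExt ρ f a x) ^ 2 * ρ x = ∑ i, l i * (∑ a, c a * W a i) ^ 2 := by
  have hexp : ∀ x, (∑ a, c a * partialExt ρ f a x) ^ 2 * ρ x =
      ∑ a, ∑ b, c a * c b * (partialExt ρ f a x * partialExt ρ f b x * ρ x) := by
    intro x
    rw [sq, Finset.sum_mul_sum, Finset.sum_mul]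
    refine Finset.sum_congr rfl fun a _ => ?_
    rw [Finset.sum_mul]
    exact Finset.sum_congr rfl fun b _ => by ring
  simp_rw [hexp]
  have hint := fun a b => (hf.integrable_mul hρ a b).const_mul (c a * c b)
  refine ⟨integrable_finsetSum _ fun a _ => integrable_finsetSum _ fun b _ => hint a b, ?_⟩
  rw [integral_finsetSum _ fun a _ => integrable_finsetSum _ fun b _ => hint a b]
  have hA : ∀ a b, ∫ x, partialExt ρ f a x * partialExt ρ f b x * ρ x = gradMatrix ρ f a b := by
    intro a b
    rw [gradMatrix, Matrix.of_apply, ← integral_indicator hρ.isOpen.measurableSet]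
    congr 1
    ext x
    by_cases hx : x ∈ domain ρ <;> simp [partialExt, hx]
  have h1 : ∀ a, ∫ x, ∑ b, c a * c b * (partialExt ρ f a x * partialExt ρ f b x * ρ x) =
      ∑ b, c a * c b * gradMatrix ρ f a b := by
    intro a
    rw [integral_finsetSum _ fun b _ => hint a b]
    exact Finset.sum_congr rfl fun b _ => by rw [integral_const_mul, hA]
  simp_rw [h1]
  have h2 : ∑ a, ∑ b, c a * c b * gradMatrix ρ f a b = c ⬝ᵥ (gradMatrix ρ f *ᵥ c) := by
    simp only [dotProduct, Matrix.mulVec, Finset.mul_sum]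
    exact Finset.sum_congr rfl fun a _ => Finset.sum_congr rfl fun b _ => by ring
  rw [h2, hW.eq_mul, ← Matrix.mulVec_mulVec, ← Matrix.mulVec_mulVec, Matrix.dotProduct_mulVec,
    ← Matrix.mulVec_transpose]
  simp only [dotProduct, Matrix.mulVec_diagonal]
  refine Finset.sum_congr rfl fun i _ => ?_
  simp only [Matrix.mulVec, dotProduct, Matrix.transpose_apply, mul_comm (W _ i)]
  ring

/-- `l i` is the integral of `(wᵢ · ∇f)² ρ`, with `wᵢ` the column `i` of `W`. -/
theorem IsAdmissible.eigenvalue_nonneg (hρ : IsPoincareDensity ρ) (hf : IsAdmissible ρ f)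
    {W : Matrix (Fin n) (Fin n) ℝ} {l : Fin n → ℝ}
    (hW : IsEigendecomposition (gradMatrix ρ f) W l) (i : Fin n) : 0 ≤ l i := by
  have h := (hf.integral_sum_mul_sq hρ hW fun a => W a i).2
  have h1 : ∀ j, ∑ a, W a i * W a j = if i = j then 1 else 0 := by
    intro j
    have := congrFun (congrFun ((Matrix.mem_orthogonalGroup_iff' _ _).1 hW.orthogonal) i) j
    simpa [Matrix.mul_apply, Matrix.one_apply] using this
  simp only [h1, ite_pow, one_pow, ne_eq, OfNat.ofNat_ne_zero, not_false_eq_true, zero_pow,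
    mul_ite, mul_one, mul_zero, Finset.sum_ite_eq, Finset.mem_univ, if_true] at h
  rw [← h]
  exact integral_nonneg fun x => mul_nonneg (sq_nonneg _) (hρ.nonneg x)

/-- The energy of `f` in the directions of the last columns of a nearby orthogonal matrix. -/
theorem IsAdmissible.lintegral_lastCols_sq_le (hρ : IsPoincareDensity ρ) (hf : IsAdmissible ρ f)
    {W : Matrix (Fin n) (Fin n) ℝ} {l : Fin n → ℝ}
    (hW : IsEigendecomposition (gradMatrix ρ f) W l) {k : ℕ} (hk : k < n)
    {Q : Matrix (Fin n) (Fin n) ℝ} (hQ : Q ∈ Matrix.orthogonalGroup (Fin n) ℝ) {ε : ℝ}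
    (hε : 0 ≤ ε) (h : spectralNorm (W - Q) ≤ ε) :
    ∫⁻ x, ENNReal.ofReal (∑ j, (∑ a, lastCols hk Q a j * partialExt ρ f a x) ^ 2) *
        ENNReal.ofReal (ρ x) ≤
      ENNReal.ofReal ((ε * √(∑ i ∈ Finset.univ.filter (fun i : Fin n => (i : ℕ) < k), l i) +
            √(∑ i ∈ Finset.univ.filter (fun i : Fin n => k ≤ (i : ℕ)), l i)) ^ 2) := by
  have hj := fun j => hf.integral_sum_mul_sq hρ hW fun a => lastCols hk Q a j
  have e1 : ∀ x, ENNReal.ofReal (∑ j, (∑ a, lastCols hk Q a j * partialExt ρ f a x) ^ 2) *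
      ENNReal.ofReal (ρ x) =
      ENNReal.ofReal (∑ j, (∑ a, lastCols hk Q a j * partialExt ρ f a x) ^ 2 * ρ x) := by
    intro x
    rw [← ENNReal.ofReal_mul (Finset.sum_nonneg fun _ _ => sq_nonneg _), Finset.sum_mul]
  simp_rw [e1]
  rw [← ofReal_integral_eq_lintegral_ofReal (integrable_finsetSum _ fun j _ => (hj j).1)
    (Eventually.of_forall fun x => Finset.sum_nonneg fun j _ =>
      mul_nonneg (sq_nonneg _) (hρ.nonneg x)),
    integral_finsetSum _ fun j _ => (hj j).1]
  refine ENNReal.ofReal_le_ofReal (le_trans (le_of_eq ?_) (sum_eigen_lastCols_le hk hW.orthogonal hQ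
    (hf.eigenvalue_nonneg hρ hW) hε h))
  simp_rw [fun j => (hj j).2]
  rw [Finset.sum_comm]
  refine Finset.sum_congr rfl fun i _ => ?_
  rw [Finset.mul_sum]
  rfl

end Admissible

/-! ### Conditional means and variances on the slices. -/

section Slices

variable {n k : ℕ} {ρ f : (Fin n → ℝ) → ℝ}

/-- The density on the slice over `y`. -/
noncomputable def sliceDensity (hk : k < n) (ρ : (Fin n → ℝ) → ℝ) (Q : Matrix (Fin n) (Fin n) ℝ)
    (p : (Fin k → ℝ) × (Fin (n - k) → ℝ)) : ENNReal :=
  ENNReal.ofReal (ρ (point hk Q p.1 p.2))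

theorem measurable_point (hk : k < n) (Q : Matrix (Fin n) (Fin n) ℝ) :
    Measurable fun p : (Fin k → ℝ) × (Fin (n - k) → ℝ) => point hk Q p.1 p.2 := by
  unfold point; fun_prop

theorem measurable_sliceDensity (hk : k < n) (hρ : Measurable ρ) (Q : Matrix (Fin n) (Fin n) ℝ) :
    Measurable (sliceDensity hk ρ Q) :=
  (hρ.comp (measurable_point hk Q)).ennreal_ofReal

theorem mul_density_eq_indicator (hρ : IsPoincareDensity ρ) (x : Fin n → ℝ) :
    f x * ρ x = (domain ρ).indicator f x * ρ x := by
  by_cases hx : x ∈ domain ρ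
  · rw [indicator_of_mem hx]
  · rw [le_antisymm (not_lt.1 hx) (hρ.nonneg x)]; simp

theorem mul_condDensity_eq (hρ : IsPoincareDensity ρ) (hk : k < n) (Q : Matrix (Fin n) (Fin n) ℝ)
    (y : Fin k → ℝ) (z : Fin (n - k) → ℝ) :
    f (point hk Q y z) * condDensity hk ρ Q y z =
      (domain ρ).indicator f (point hk Q y z) * (sliceDensity hk ρ Q (y, z)).toReal /
        (∫⁻ z, sliceDensity hk ρ Q (y, z)).toReal := by
  have hm := hρ.measurable
  have h1 : marginalDensity hk ρ Q y = (∫⁻ z, sliceDensity hk ρ Q (y, z)).toReal := by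
    refine integral_eq_lintegral_of_nonneg_ae (Eventually.of_forall fun z => hρ.nonneg _) ?_
    have : Measurable fun z => point hk Q y z := by unfold point; fun_prop
    exact (hm.comp this).aestronglyMeasurable
  rw [condDensity, h1, ← mul_div_assoc, jointDensity, mul_density_eq_indicator hρ, sliceDensity,
    ENNReal.toReal_ofReal (hρ.nonneg _)]

/-- The conditional mean exists and the conditional variance is bounded by the mean square
increment. -/
theorem integrable_condMean_and_lintegral_le (hρ : IsPoincareDensity ρ) (hf : IsAdmissible ρ f)
    (hk : k < n) (Q : Matrix (Fin n) (Fin n) ℝ) (y : Fin k → ℝ)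
    (hm : ∫⁻ z, sliceDensity hk ρ Q (y, z) ≠ ⊤)
    (hJ : (∫⁻ z, sliceDensity hk ρ Q (y, z))⁻¹ * ∫⁻ z, ∫⁻ z',
      ‖(domain ρ).indicator f (point hk Q y z') - (domain ρ).indicator f (point hk Q y z)‖ₑ ^ 2 *
        (sliceDensity hk ρ Q (y, z) * sliceDensity hk ρ Q (y, z')) ≠ ⊤) :
    (Integrable fun z => f (point hk Q y z) * condDensity hk ρ Q y z) ∧
      ∫⁻ z, ‖(domain ρ).indicator f (point hk Q y z) - condMean hk ρ f Q y‖ₑ ^ 2 *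
        sliceDensity hk ρ Q (y, z) ≤
      (∫⁻ z, sliceDensity hk ρ Q (y, z))⁻¹ * ∫⁻ z, ∫⁻ z',
      ‖(domain ρ).indicator f (point hk Q y z') - (domain ρ).indicator f (point hk Q y z)‖ₑ ^ 2 *
        (sliceDensity hk ρ Q (y, z) * sliceDensity hk ρ Q (y, z')) := by
  have hp : Measurable fun z => point hk Q y z := by unfold point; fun_prop
  set q : (Fin (n - k) → ℝ) → ENNReal := fun z => sliceDensity hk ρ Q (y, z) with hq
  set F : (Fin (n - k) → ℝ) → ℝ := fun z => (domain ρ).indicator f (point hk Q y z) with hF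
  have hqm : Measurable q := by
    have := measurable_sliceDensity hk hρ.measurable Q
    fun_prop
  have hFm : Measurable F := (hf.measurable_indicator hρ).comp hp
  have hqtop : ∀ᵐ z, q z < ⊤ := Eventually.of_forall fun z => ENNReal.ofReal_lt_top
  have hfc : (fun z => f (point hk Q y z) * condDensity hk ρ Q y z) =
      fun z => F z * (q z).toReal / (∫⁻ z, q z).toReal := by
    ext z; exact mul_condDensity_eq hρ hk Q y z
  have hcm : condMean hk ρ f Q y = ∫ z, F z * (q z).toReal / (∫⁻ z, q z).toReal := by
    rw [condMean, hfc]
  rw [hfc, hcm]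
  change (∫⁻ z, q z)⁻¹ * ∫⁻ z, ∫⁻ z', ‖F z' - F z‖ₑ ^ 2 * (q z * q z') ≠ ⊤ at hJ
  change ∫⁻ z, q z ≠ ⊤ at hm
  -- On a slice of zero mass, division by zero makes the integrand of the conditional mean vanish,
  -- and the variance integral vanishes with `q`.
  by_cases h0 : ∫⁻ z, q z = 0
  · have hae := (lintegral_eq_zero_iff hqm).1 h0
    refine ⟨by simp [h0], ?_⟩
    refine le_trans (le_of_eq ((lintegral_congr_ae ?_).trans lintegral_zero)) zero_le
    filter_upwards [hae] with z hz
    change _ * q z = 0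
    rw [hz]; simp
  set ν := (volume : Measure (Fin (n - k) → ℝ)).withDensity q with hν
  have hνu : ν univ = ∫⁻ z, q z := by rw [hν, withDensity_apply _ .univ, setLIntegral_univ]
  have : IsFiniteMeasure ν := ⟨by rw [hνu]; exact hm.lt_top⟩
  have hν0 : ν ≠ 0 := by
    intro h; rw [h] at hνu; simp at hνu; exact h0 hνu.symm
  have hdouble : ∫⁻ z, ∫⁻ z', ‖F z' - F z‖ₑ ^ 2 ∂ν ∂ν =
      ∫⁻ z, ∫⁻ z', ‖F z' - F z‖ₑ ^ 2 * (q z * q z') := by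
    rw [hν, lintegral_withDensity_eq_lintegral_mul _ hqm]
    · refine lintegral_congr fun z => ?_
      rw [Pi.mul_apply, lintegral_withDensity_eq_lintegral_mul _ hqm (by fun_prop),
        ← lintegral_const_mul _ (by fun_prop)]
      refine lintegral_congr fun z' => ?_
      rw [Pi.mul_apply]
      ring
    · exact Measurable.lintegral_prod_right' (f := fun r : (Fin (n - k) → ℝ) × (Fin (n - k) → ℝ) =>
        ‖F r.2 - F r.1‖ₑ ^ 2) (by fun_prop)
  -- As the mass is finite, its inverse is nonzero and cannot hide an infinite double integral in
  -- `hJ`.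
  have hJ' : ∫⁻ z, ∫⁻ z', ‖F z' - F z‖ₑ ^ 2 ∂ν ∂ν ≠ ⊤ := by
    rw [hdouble]
    intro h
    rw [h] at hJ
    exact hJ (ENNReal.mul_top (by simpa using hm))
  obtain ⟨hint, hle⟩ := integrable_and_lintegral_sub_average_sq_le hν0 hFm hJ'
  refine ⟨((integrable_withDensity_iff hqm hqtop).1 hint).div_const _, ?_⟩
  have hav : ⨍ z, F z ∂ν = ∫ z, F z * (q z).toReal / (∫⁻ z, q z).toReal := by
    rw [average_eq, measureReal_def, hνu, hν,
      integral_withDensity_eq_integral_toReal_smul hqm hqtop, integral_div, smul_eq_mul,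
      inv_mul_eq_div]
    congr 2
    ext z
    rw [smul_eq_mul, mul_comm]
  rw [hdouble, hνu, hav] at hle
  refine le_trans (le_of_eq ?_) hle
  rw [hν, lintegral_withDensity_eq_lintegral_mul _ hqm (by fun_prop)]
  refine lintegral_congr fun z => ?_
  rw [Pi.mul_apply, mul_comm]

theorem measurable_condMean (hρ : IsPoincareDensity ρ) (hf : IsAdmissible ρ f)
    (hk : k < n) (Q : Matrix (Fin n) (Fin n) ℝ) : Measurable (condMean hk ρ f Q) := by
  have hq := measurable_sliceDensity hk hρ.measurable Q
  have hF := (hf.measurable_indicator hρ).comp (measurable_point hk Q)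
  have hm : Measurable fun y => ∫⁻ z, sliceDensity hk ρ Q (y, z) := hq.lintegral_prod_right'
  have h : Measurable fun p : (Fin k → ℝ) × (Fin (n - k) → ℝ) =>
      (domain ρ).indicator f (point hk Q p.1 p.2) * (sliceDensity hk ρ Q p).toReal /
        (∫⁻ z, sliceDensity hk ρ Q (p.1, z)).toReal := by
    refine (Measurable.mul hF hq.ennreal_toReal).div ?_
    exact (hm.comp measurable_fst).ennreal_toReal
  have h2 := h.stronglyMeasurable.integral_prod_right' (ν := volume)
  convert! h2.measurable using 1
  ext y
  simp only [condMean, mul_condDensity_eq hρ]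

/-- The mean square increments of `f` in the slices are bounded by the energy of `f` in the
directions of the slices. -/
theorem lintegral_increment_le (hρ : IsPoincareDensity ρ) (hf : IsAdmissible ρ f)
    (hk : k < n) {Q : Matrix (Fin n) (Fin n) ℝ} (hQ : Q ∈ Matrix.orthogonalGroup (Fin n) ℝ)
    {a : ℝ → ENNReal} (ham : Measurable a) (ha : ∀ τ ∈ Ioo (0 : ℝ) 1, a τ ≠ 0 ∧ a τ ≠ ⊤)
    (hq : ∀ τ ∈ Ioo (0 : ℝ) 1, ∀ y u,
      ∫⁻ v, ENNReal.ofReal (∑ j, v j ^ 2) * (ENNReal.ofReal (ρ (point hk Q y (u - τ • v))) *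
        ENNReal.ofReal (ρ (point hk Q y (u + (1 - τ) • v)))) ≤
      a τ ^ 2 * (ENNReal.ofReal (ρ (point hk Q y u)) *
        ∫⁻ z, ENNReal.ofReal (ρ (point hk Q y z)))) :
    ∫⁻ y, (∫⁻ z, sliceDensity hk ρ Q (y, z))⁻¹ * ∫⁻ z, ∫⁻ z',
      ‖(domain ρ).indicator f (point hk Q y z') - (domain ρ).indicator f (point hk Q y z)‖ₑ ^ 2 *
        (sliceDensity hk ρ Q (y, z) * sliceDensity hk ρ Q (y, z')) ≤
      (∫⁻ τ in Ioo (0 : ℝ) 1, a τ) ^ 2 *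
        ∫⁻ x, ENNReal.ofReal (∑ j, (∑ i, lastCols hk Q i j * partialExt ρ f i x) ^ 2) *
          ENNReal.ofReal (ρ x) := by
  have hpm := measurable_point hk Q
  have hgm := hf.measurable_partialExt hρ
  have hFm := hf.measurable_indicator hρ
  have hρm := hρ.measurable
  have hmp := measurePreserving_point hk hQ
  have h := lintegral_slice_sub_sq_le (Y := Fin k → ℝ) (q := sliceDensity hk ρ Q)
    (measurable_sliceDensity hk hρm Q)
    (F := fun p => (domain ρ).indicator f (point hk Q p.1 p.2)) (hFm.comp hpm)
    (H := fun j p => ∑ i, lastCols hk Q i j * partialExt ρ f i (point hk Q p.1 p.2))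
    (fun j => Finset.measurable_sum _ fun i _ => ((hgm i).comp hpm).const_mul _) ?_ ham ha hq
  · refine h.trans_eq ?_
    congr 1
    rw [← hmp.lintegral_comp (f := fun x =>
      ENNReal.ofReal (∑ j, (∑ i, lastCols hk Q i j * partialExt ρ f i x) ^ 2) *
          ENNReal.ofReal (ρ x)) (by fun_prop), lintegral_prod]
    · rfl
    · refine Measurable.aemeasurable ?_
      exact Measurable.comp (g := fun x =>
        ENNReal.ofReal (∑ j, (∑ i, lastCols hk Q i j * partialExt ρ f i x) ^ 2) *
          ENNReal.ofReal (ρ x)) (by fun_prop) hpm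
  · intro v
    -- Moving by `v` within a slice is moving by `lastCols hk Q *ᵥ v` in the whole space; the
    -- exceptional null set there pulls back to a null set of pairs `(y, z)`.
    have hae := ae_enorm_sub_le_lintegral hρ.convex hρ.isOpen hgm
      (fun i R => hf.integrableOn_partialExt hρ i R)
      (fun x hx i => hf.hasDerivAt_indicator hρ hx i) (lastCols hk Q *ᵥ v)
    have hae' := hmp.quasiMeasurePreserving.ae hae
    have hadd : ∀ (p : (Fin k → ℝ) × (Fin (n - k) → ℝ)) (c : ℝ), point hk Q p.1 (p.2 + c • v) =
        point hk Q p.1 p.2 + c • (lastCols hk Q *ᵥ v) := by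
      intro p c
      simp only [point, Matrix.mulVec_add, Matrix.mulVec_smul, add_assoc]
    have hadd1 : ∀ p : (Fin k → ℝ) × (Fin (n - k) → ℝ), point hk Q p.1 (p.2 + v) =
        point hk Q p.1 p.2 + lastCols hk Q *ᵥ v := by
      intro p
      simpa using hadd p 1
    have hdom : ∀ p : (Fin k → ℝ) × (Fin (n - k) → ℝ), sliceDensity hk ρ Q p ≠ 0 →
        point hk Q p.1 p.2 ∈ domain ρ := by
      intro p hp
      exact ENNReal.ofReal_pos.1 (pos_iff_ne_zero.2 hp)
    filter_upwards [hae'] with p hp h1 h2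
    have h3 := hp (hdom p h1) (by rw [← hadd1]; exact hdom _ h2)
    simp only [hadd, hadd1]
    refine h3.trans_eq (lintegral_congr fun τ => ?_)
    congr 1
    simp only [Matrix.mulVec, dotProduct, Finset.sum_mul, Finset.mul_sum]
    rw [Finset.sum_comm]
    refine Finset.sum_congr rfl fun j _ => Finset.sum_congr rfl fun i _ => ?_
    ring

/-- In the coordinates `(y, z)` this map is the first projection. It turns "almost every `y`" into
"almost every `x`". -/
theorem quasiMeasurePreserving_firstCols (hk : k < n) {Q : Matrix (Fin n) (Fin n) ℝ}
    (hQ : Q ∈ Matrix.orthogonalGroup (Fin n) ℝ) :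
    Measure.QuasiMeasurePreserving (fun x : Fin n → ℝ => (firstCols hk Q)ᵀ *ᵥ x) := by
  have hm : Measurable (fun x : Fin n → ℝ => (firstCols hk Q)ᵀ *ᵥ x) := by fun_prop
  refine ⟨hm, ?_⟩
  rw [← (measurePreserving_point hk hQ).map_eq, Measure.map_map hm (measurable_point hk Q)]
  have : ((fun x : Fin n → ℝ => (firstCols hk Q)ᵀ *ᵥ x) ∘
      fun p : (Fin k → ℝ) × (Fin (n - k) → ℝ) => point hk Q p.1 p.2) = Prod.fst := by
    ext1 p
    exact firstCols_transpose_mulVec_point hk hQ p.1 p.2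
  rw [this]
  exact Measure.quasiMeasurePreserving_fst.absolutelyContinuous

/-- The conditional means of `f` exist and the error of the ridge approximation is bounded by the
energy of `f` in the directions of the slices. -/
theorem ae_integrable_and_lintegral_ridge_le (hρ : IsPoincareDensity ρ)
    (hmass : ∫⁻ x, ENNReal.ofReal (ρ x) ≠ ⊤) (hf : IsAdmissible ρ f)
    (hk : k < n) {Q : Matrix (Fin n) (Fin n) ℝ} (hQ : Q ∈ Matrix.orthogonalGroup (Fin n) ℝ)
    {T : ENNReal} (hT : T ≠ ⊤)
    (h : ∫⁻ y, (∫⁻ z, sliceDensity hk ρ Q (y, z))⁻¹ * ∫⁻ z, ∫⁻ z',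
      ‖(domain ρ).indicator f (point hk Q y z') - (domain ρ).indicator f (point hk Q y z)‖ₑ ^ 2 *
        (sliceDensity hk ρ Q (y, z) * sliceDensity hk ρ Q (y, z')) ≤ T) :
    (∀ᵐ y, Integrable fun z => f (point hk Q y z) * condDensity hk ρ Q y z) ∧
      ∫⁻ x, ‖(domain ρ).indicator f x - ridgeApprox hk ρ f Q x‖ₑ ^ 2 *
        ENNReal.ofReal (ρ x) ≤ T := by
  have hpm := measurable_point hk Q
  have hqm := measurable_sliceDensity hk hρ.measurable Q
  have hFm := hf.measurable_indicator hρ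
  have hρm := hρ.measurable
  have hmp := measurePreserving_point hk hQ
  have hmm : Measurable fun y => ∫⁻ z, sliceDensity hk ρ Q (y, z) := hqm.lintegral_prod_right'
  have hm1 : ∀ᵐ y, ∫⁻ z, sliceDensity hk ρ Q (y, z) < ⊤ := by
    refine ae_lt_top hmm ?_
    rw [← lintegral_prod _ hqm.aemeasurable]
    rw [← hmp.lintegral_comp (by fun_prop)] at hmass
    exact hmass
  have hJm : Measurable fun y => (∫⁻ z, sliceDensity hk ρ Q (y, z))⁻¹ * ∫⁻ z, ∫⁻ z',
      ‖(domain ρ).indicator f (point hk Q y z') - (domain ρ).indicator f (point hk Q y z)‖ₑ ^ 2 *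
        (sliceDensity hk ρ Q (y, z) * sliceDensity hk ρ Q (y, z')) := by
    refine hmm.inv.mul (Measurable.lintegral_prod_right'
      (f := fun r : (Fin k → ℝ) × (Fin (n - k) → ℝ) => ∫⁻ z',
      ‖(domain ρ).indicator f (point hk Q r.1 z') -
        (domain ρ).indicator f (point hk Q r.1 r.2)‖ₑ ^ 2 *
        (sliceDensity hk ρ Q r * sliceDensity hk ρ Q (r.1, z'))) ?_)
    have hFp := hFm.comp hpm
    refine Measurable.lintegral_prod_right'
      (f := fun r : ((Fin k → ℝ) × (Fin (n - k) → ℝ)) × (Fin (n - k) → ℝ) =>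
      ‖(domain ρ).indicator f (point hk Q r.1.1 r.2) -
        (domain ρ).indicator f (point hk Q r.1.1 r.1.2)‖ₑ ^ 2 *
        (sliceDensity hk ρ Q r.1 * sliceDensity hk ρ Q (r.1.1, r.2))) ?_
    have h1 : Measurable fun r : ((Fin k → ℝ) × (Fin (n - k) → ℝ)) × (Fin (n - k) → ℝ) =>
        (domain ρ).indicator f (point hk Q r.1.1 r.2) :=
      hFp.comp (measurable_fst.fst.prodMk measurable_snd)
    have h2 : Measurable fun r : ((Fin k → ℝ) × (Fin (n - k) → ℝ)) × (Fin (n - k) → ℝ) =>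
        (domain ρ).indicator f (point hk Q r.1.1 r.1.2) := hFp.comp measurable_fst
    fun_prop
  have hJ := ae_lt_top hJm (ne_top_of_le_ne_top hT h)
  have hboth := (hm1.and hJ).mono fun y hy =>
    integrable_condMean_and_lintegral_le hρ hf hk Q y hy.1.ne hy.2.ne
  refine ⟨hboth.mono fun y hy => hy.1, ?_⟩
  have hrm : Measurable (ridgeApprox hk ρ f Q) :=
    (measurable_condMean hρ hf hk Q).comp (by fun_prop)
  have hm : Measurable fun x => ‖(domain ρ).indicator f x - ridgeApprox hk ρ f Q x‖ₑ ^ 2 *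
        ENNReal.ofReal (ρ x) := by fun_prop
  have hmc := hm.comp hpm
  simp only [Function.comp_def] at hmc
  rw [← hmp.lintegral_comp hm, lintegral_prod _ hmc.aemeasurable]
  refine le_trans (lintegral_mono_ae ?_) h
  filter_upwards [hboth] with y hy
  refine le_trans (le_of_eq ?_) hy.2
  refine lintegral_congr fun z => ?_
  simp only [ridgeApprox, firstCols_transpose_mulVec_point hk hQ]
  rfl

end Slices

end ActiveSubspace

/-! ### The main theorem: transfer to the random variable. -/

open ActiveSubspace in
theorem mainTheorem7 {n : ℕ} (ρ : (Fin n → ℝ) → ℝ)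
    (hρ : ActiveSubspace.IsUniformOnConvex ρ ∨ ρ = ActiveSubspace.stdNormalDensity n) :
    ∃ C : ℝ, 0 < C ∧
      ∀ (Ω : Type*) [MeasurableSpace Ω] (P : Measure Ω) [IsProbabilityMeasure P]
        (X : Ω → Fin n → ℝ), Measurable X →
        P.map X = (volume : Measure (Fin n → ℝ)).withDensity (fun x => ENNReal.ofReal (ρ x)) →
      ∀ f : (Fin n → ℝ) → ℝ, ActiveSubspace.IsAdmissible ρ f →
      ∀ (W : Matrix (Fin n) (Fin n) ℝ) (l : Fin n → ℝ),
        ActiveSubspace.IsEigendecomposition (ActiveSubspace.gradMatrix ρ f) W l →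
      ∀ (k : ℕ) (_ : 1 ≤ k) (hk : k < n),
      ∀ What ∈ Matrix.orthogonalGroup (Fin n) ℝ,
      ∀ ε : ℝ, 0 < ε → ActiveSubspace.spectralNorm (W - What) ≤ ε →
        (∀ᵐ ω ∂P, Integrable fun z : Fin (n - k) → ℝ =>
          f (ActiveSubspace.point hk What ((ActiveSubspace.firstCols hk What)ᵀ *ᵥ X ω) z) *
            ActiveSubspace.condDensity hk ρ What
              ((ActiveSubspace.firstCols hk What)ᵀ *ᵥ X ω) z) ∧
        Integrable (fun ω => (f (X ω) - ActiveSubspace.ridgeApprox hk ρ f What (X ω)) ^ 2) P ∧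
        ∫ ω, (f (X ω) - ActiveSubspace.ridgeApprox hk ρ f What (X ω)) ^ 2 ∂P ≤
          C * (ε * √(∑ i ∈ Finset.univ.filter (fun i : Fin n => (i : ℕ) < k), l i) +
            √(∑ i ∈ Finset.univ.filter (fun i : Fin n => k ≤ (i : ℕ)), l i)) ^ 2 := by
  have hρ' : IsPoincareDensity ρ := by
    rcases hρ with h | rfl
    · exact h.isPoincareDensity
    · exact isPoincareDensity_stdNormalDensity n
  obtain ⟨a, ham, ha, hatop, hker⟩ := hρ'.kernel_bound
  set M := ∫⁻ τ in Set.Ioo (0 : ℝ) 1, a τ with hM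
  -- The Poincaré constant `M ^ 2` comes from `ρ` alone; the `+ 1` only ensures positivity.
  refine ⟨(M ^ 2).toReal + 1, by positivity, ?_⟩
  intro Ω _ P _ X hX hlaw f hf W l hW k _ hk Q hQ ε hε hspec
  set B := (ε * √(∑ i ∈ Finset.univ.filter (fun i : Fin n => (i : ℕ) < k), l i) +
            √(∑ i ∈ Finset.univ.filter (fun i : Fin n => k ≤ (i : ℕ)), l i)) ^ 2 with hB
  have hρm := hρ'.measurable
  have hB0 : 0 ≤ B := sq_nonneg _
  have hmass : ∫⁻ x, ENNReal.ofReal (ρ x) ≠ ⊤ := by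
    have h1 : (P.map X) Set.univ = ∫⁻ x, ENNReal.ofReal (ρ x) := by
      rw [hlaw, withDensity_apply _ .univ, setLIntegral_univ]
    have := Measure.isProbabilityMeasure_map (μ := P) hX.aemeasurable
    rw [← h1]
    exact measure_ne_top _ _
  have hinc := lintegral_increment_le hρ' hf hk hQ ham ha (hker k hk Q hQ)
  obtain ⟨hae, hle⟩ := ae_integrable_and_lintegral_ridge_le hρ' hmass hf hk hQ
    (T := M ^ 2 * ENNReal.ofReal B) (ENNReal.mul_ne_top (by simpa using hatop) (by simp))
    (hinc.trans (by gcongr; exact hf.lintegral_lastCols_sq_le hρ' hW hk hQ hε.le hspec))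
  have hac : P.map X ≪ volume := by rw [hlaw]; exact withDensity_absolutelyContinuous _ _
  -- `X` lies in the domain almost surely, so the uncontrolled values of `f` outside it do not
  -- matter.
  have hF : ∀ᵐ ω ∂P, (domain ρ).indicator f (X ω) = f (X ω) := by
    refine ae_of_ae_map (p := fun x => (domain ρ).indicator f x = f x) hX.aemeasurable ?_
    rw [hlaw, ae_withDensity_iff (by fun_prop)]
    refine Filter.Eventually.of_forall fun x hx => Set.indicator_of_mem ?_ f
    exact ENNReal.ofReal_pos.1 (pos_iff_ne_zero.2 hx)
  have hFm := hf.measurable_indicator hρ'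
  have hrm : Measurable (ridgeApprox hk ρ f Q) :=
    (measurable_condMean hρ' hf hk Q).comp (by fun_prop)
  have hlin : ∫⁻ ω, ‖(domain ρ).indicator f (X ω) - ridgeApprox hk ρ f Q (X ω)‖ₑ ^ 2 ∂P ≤
      M ^ 2 * ENNReal.ofReal B := by
    rw [← lintegral_map (f := fun x => ‖(domain ρ).indicator f x - ridgeApprox hk ρ f Q x‖ₑ ^ 2)
      (by fun_prop) hX, hlaw, lintegral_withDensity_eq_lintegral_mul _ (by fun_prop) (by fun_prop)]
    refine le_trans (le_of_eq (lintegral_congr fun x => ?_)) hle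
    rw [Pi.mul_apply, mul_comm]
  have hfin : M ^ 2 * ENNReal.ofReal B < ⊤ :=
    ENNReal.mul_lt_top (by simpa using hatop.lt_top) (by simp)
  have hcongr : (fun ω => ((domain ρ).indicator f (X ω) - ridgeApprox hk ρ f Q (X ω)) ^ 2) =ᵐ[P]
      fun ω => (f (X ω) - ridgeApprox hk ρ f Q (X ω)) ^ 2 := by
    filter_upwards [hF] with ω hω
    rw [hω]
  have hmeas : Measurable fun ω =>
      ((domain ρ).indicator f (X ω) - ridgeApprox hk ρ f Q (X ω)) ^ 2 :=
    ((hFm.comp hX).sub (hrm.comp hX)).pow_const 2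
  refine ⟨?_, ?_, ?_⟩
  · exact ae_of_ae_map hX.aemeasurable
      (hac.ae_le ((quasiMeasurePreserving_firstCols hk hQ).ae hae))
  · refine Integrable.congr ⟨hmeas.aestronglyMeasurable, ?_⟩ hcongr
    rw [HasFiniteIntegral]
    simp only [enorm_pow]
    exact hlin.trans_lt hfin
  · rw [← integral_congr_ae hcongr,
      integral_eq_lintegral_of_nonneg_ae (Filter.Eventually.of_forall fun ω => sq_nonneg _)
        hmeas.aestronglyMeasurable]
    have h1 : ∀ ω, ENNReal.ofReal
        (((domain ρ).indicator f (X ω) - ridgeApprox hk ρ f Q (X ω)) ^ 2) =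
        ‖(domain ρ).indicator f (X ω) - ridgeApprox hk ρ f Q (X ω)‖ₑ ^ 2 := by
      intro ω
      rw [← enorm_pow, Real.enorm_of_nonneg (sq_nonneg _)]
    simp_rw [h1]
    refine (ENNReal.toReal_mono hfin.ne hlin).trans ?_
    rw [ENNReal.toReal_mul, ENNReal.toReal_ofReal hB0]
    gcongr
    linarith
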